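/- Throughout, $\alpha>-1$ is real, $j,k,l,J,K,L$ are nonnegative integers, $(a)_n=a(a+1)\cdots(a+n-1)$, $(a)_0=1$, and ${}_pF_q$ denotes the generalized hypergeometric series. For $0\le n\le N$ let \[ Q_n(x;\alpha,\beta,N)={}_3F_2\!\left({-n,\,n+\alpha+\beta+1,\,-x\atop \alpha+1,\,-N};1\right) \] be the Hahn polynomials, let $R_n(\lambda(x);\gamma,\delta,N)={}_3F_2\!\left({-n,\,-x,\,x+\gamma+\delta+1\atop \gamma+1,\,-N};1\right)$, $\lambda(x)=x(x+\gamma+\delta+1)$, be the dual Hahn polynomials, and put \[ w(x;\alpha,\beta,N)=\binom{\alpha+x}{x}\binom{N+\beta-x}{N-x},\qquad h(n;\alpha,\beta,N)=\frac{(n+\alpha+\beta+1)_{N+1}(\beta+1)_n\,n!}{(2n+\alpha+\beta+1)(\alpha+1)_n(N-n+1)_n\,N!}, \] where for $n=0$ the quotient $(\alpha+\beta+1)_{N+1}/(\alpha+\beta+1)$ is read as $(\alpha+\beta+2)_N$; let $\tilde Q_n(x;\alpha,\beta,N)=\sqrt{w(x;\alpha,\beta,N)}\,Q_n(x;\alpha,\beta,N)/\sqrt{h(n;\alpha,\beta,N)}$.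 For $0\le k,l\le j$ let \[ S(k,l,\alpha,j)=\sum_{n=0}^{j}(-1)^n\,w(n;\alpha,\alpha,j)\,Q_k(n;\alpha,\alpha,j)\,Q_l(n;\alpha,\alpha,j). \] This is the Poisson kernel for dual Hahn polynomials $\sum_{n=0}^j t^n\binom{\alpha+n}{n}\binom{\beta+j-n}{j-n}R_n(\lambda(k);\alpha,\beta,j)R_n(\lambda(l);\alpha,\beta,j)$ at $t=-1$, $\beta=\alpha$. (1) For $0\le k,l\le j$ one has $S(k,l,\alpha,j)=(-1)^{k+l+j}S(k,l,\alpha,j)$, so $S(k,l,\alpha,j)=0$ whenever $k+l+j$ is odd. (2) In the other cases, for all $K,L,J\geq 0$ for which both of the first two arguments of $S$ are at most the last one, \[ S(2K,2L,\alpha,2J)=\frac{2^{2J}(\frac12)_{J-K}(\frac12)_{J-L}(\alpha+1)_J(\alpha+J+1)_K(\alpha+J+1)_L}{(2J)!\,(\frac12)_J}\;{}_4F_3\!\left({-K,\,K+\alpha+\frac12,\,-L,\,L+\alpha+\frac12\atop \alpha+J+1,\,\alpha+1,\,-J};1\right), \] \[ S(2K+1,2L+1,\alpha,2J)=\frac{2^{2J}(\frac12)_{J-K}(\frac12)_{J-L}(\alpha+1)_{J+1}(\alpha+J+2)_K(\alpha+J+2)_L}{(2J)!\,J\,(\frac12)_J}\;{}_4F_3\!\left({-K,\,K+\alpha+\frac32,\,-L,\,L+\alpha+\frac32\atop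 \alpha+J+2,\,\alpha+1,\,-J+1};1\right), \] \[ S(2K,2L+1,\alpha,2J+1)=\frac{2^{2J+1}(\frac12)_{J-K+1}(\frac12)_{J-L}(\alpha+1)_{J+1}(\alpha+J+2)_K(\alpha+J+2)_L}{(2J+1)!\,(\frac12)_{J+1}}\;{}_4F_3\!\left({-K,\,K+\alpha+\frac12,\,-L,\,L+\alpha+\frac32\atop \alpha+J+2,\,\alpha+1,\,-J};1\right), \] and $S(2L+1,2K,\alpha,2J+1)=S(2K,2L+1,\alpha,2J+1)$ is given by the same right hand side. All these ${}_4F_3(1)$ series are terminating and Saalschützian. (3) Let $U$ be the real $(2j+1)\times(2j+1)$ matrix with entries ($0\le i\le j$ in even rows, $0\le i\le j-1$ in odd rows, $1\le k\le j$) \[ U_{2i,j}=(-1)^i\tilde Q_0(i;\alpha,\alpha,j),\quad U_{2i+1,j}=0,\quad U_{2i,j\pm k}=\tfrac{(-1)^i}{\sqrt2}\tilde Q_k(i;\alpha,\alpha,j),\quad U_{2i+1,j\pm k}=\pm\tfrac{(-1)^i}{\sqrt2}\tilde Q_{k-1}(i;\alpha+1,\alpha+1,j-1), \] let $V_{r,s}=-i^{\,r+1}U_{r,s}$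 (here $i^2=-1$), and let $F=U^TV$ be the discrete Hahn–Fourier matrix. Then every entry of $F$ is, up to an explicit factor, a Racah polynomial \[ R_n(\lambda(x);a,b,c,d)={}_4F_3\!\left({-n,\,n+a+b+1,\,-x,\,x+c+d+1\atop a+1,\,b+d+1,\,c+1};1\right). \] Precisely, for $k+l+j$ even let $C(k,l,\alpha,j)$ be the prefactor of the series in (2), and let $\mathcal R(k,l,\alpha,j)$ be, with $\lambda(x)=x(x+c+d+1)$ for the respective $c,d$, \[ \begin{aligned} &R_K(\lambda(L);\alpha,-\tfrac12,-J-1,\alpha+J+\tfrac12) && \text{if }(k,l,j)=(2K,2L,2J),\\ &R_K(\lambda(L);\alpha,\tfrac12,-J,\alpha+J+\tfrac12) && \text{if }(k,l,j)=(2K+1,2L+1,2J),\\ &R_K(\lambda(L);\alpha,-\tfrac12,-J-1,\alpha+J+\tfrac32) && \text{if }(k,l,j)=(2K,2L+1,2J+1)\text{ or }(2L+1,2K,2J+1).\end{aligned} \] Put $c_0=1$ and $c_k=1/\sqrt2$ for $k\ge1$. For $0\le k,l\le j$ and signs $\sigma,\tau\in\{1,-1\}$: – if $k+l+j$ is even,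 then \[ F_{j+\sigma k,\,j+\tau l}=-i\,\frac{c_kc_l\,C(k,l,\alpha,j)}{\sqrt{h(k;\alpha,\alpha,j)\,h(l;\alpha,\alpha,j)}}\;\mathcal R(k,l,\alpha,j); \] – if $k+l+j$ is odd and $k,l\ge1$, then \[ F_{j+\sigma k,\,j+\tau l}=\frac{\sigma\tau\,C(k-1,l-1,\alpha+1,j-1)}{2\sqrt{h(k-1;\alpha+1,\alpha+1,j-1)\,h(l-1;\alpha+1,\alpha+1,j-1)}}\;\mathcal R(k-1,l-1,\alpha+1,j-1); \] – if $k+l+j$ is odd and $k=0$ or $l=0$, then $F_{j+\sigma k,\,j+\tau l}=0$. In the first two cases the factor in front of $\mathcal R$, apart from $-i$ and $\sigma\tau$ respectively, is a positive real number. -/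

import Mathlib

open scoped Nat

noncomputable section

/-- The Pochhammer symbol `(a)_n = a (a + 1) ⋯ (a + n - 1)`. -/
def poch (a : ℝ) (n : ℕ) : ℝ := (ascPochhammer ℝ n).eval a

/-- The generalized hypergeometric series with upper parameters `as`, lower parameters `bs` and
argument `z`. If an upper parameter is `-K` with `K` a natural number, all terms with index
larger than `K` are zero (also when a lower parameter is a negative integer `-N` with `K ≤ N`,
which is the usual convention for terminating series). -/
def hypSeries (as bs : List ℝ) (z : ℝ) : ℝ :=
  ∑' n : ℕ, (as.map fun a => poch a n).prod / ((bs.map fun b => poch b n).prod * (n ! : ℝ)) * z ^ n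

/-- The parameters of a terminating Saalschützian series `_{p+1}F_p(1)`: the lower parameters sum
to one plus the sum of the upper parameters, some upper parameter is `-K` with `K` a natural
number, and no lower parameter produces a zero denominator up to the term with index `K`. -/
def IsTerminatingSaalschutzian (as bs : List ℝ) : Prop :=
  as.length = bs.length + 1 ∧ bs.sum = 1 + as.sum ∧
    ∃ K : ℕ, -(K : ℝ) ∈ as ∧ ∀ b ∈ bs, ∀ i < K, b + (i : ℝ) ≠ 0

/-- The Hahn polynomial `Q_n(x; α, β, N)`, for `0 ≤ n ≤ N`. -/
def hahnQ (n : ℕ) (x α β : ℝ) (N : ℕ) : ℝ :=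
  hypSeries [-(n : ℝ), (n : ℝ) + α + β + 1, -x] [α + 1, -(N : ℝ)] 1

/-- The dual Hahn polynomial `R_n(λ(x); γ, δ, N)`, `λ(x) = x (x + γ + δ + 1)`, for `0 ≤ n ≤ N`. -/
def dualHahnR (n : ℕ) (x γ δ : ℝ) (N : ℕ) : ℝ :=
  hypSeries [-(n : ℝ), -x, x + γ + δ + 1] [γ + 1, -(N : ℝ)] 1

/-- The Racah polynomial `R_n(λ(x); α, β, γ, δ)`, `λ(x) = x (x + γ + δ + 1)`, where one of
`α + 1`, `β + δ + 1`, `γ + 1` equals `-N` and `n`, `x` lie in `{0, …, N}`. -/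
def racahR (n : ℕ) (x α β γ δ : ℝ) : ℝ :=
  hypSeries [-(n : ℝ), (n : ℝ) + α + β + 1, -x, x + γ + δ + 1] [α + 1, β + δ + 1, γ + 1] 1

/-- The weight `w(x; α, β, N) = binom(α + x, x) binom(N + β - x, N - x)`, for `0 ≤ x ≤ N`. -/
def hahnW (x : ℕ) (α β : ℝ) (N : ℕ) : ℝ :=
  Ring.choose (α + (x : ℝ)) x * Ring.choose ((N : ℝ) + β - (x : ℝ)) (N - x)

/-- The squared norm `h(n; α, β, N)` of the Hahn polynomials, for `0 ≤ n ≤ N`. The usual quotient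
`(n + α + β + 1)_{N + 1} / (2 n + α + β + 1)` is written as
`(n + α + β + 1)_n (2 n + α + β + 2)_{N - n}`, which also has the right value
for `n = 0` and `α + β + 1 = 0`. -/
def hahnH (n : ℕ) (α β : ℝ) (N : ℕ) : ℝ :=
  poch ((n : ℝ) + α + β + 1) n * poch (2 * (n : ℝ) + α + β + 2) (N - n) * poch (β + 1) n * (n ! : ℝ) /
    (poch (α + 1) n * poch ((N : ℝ) - n + 1) n * (N ! : ℝ))

theorem poch_add (a : ℝ) (m n : ℕ) : poch a (m + n) = poch a m * poch (a + m) n := by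
  unfold poch
  rw [← ascPochhammer_mul]
  simp

/-- The agreement of `hahnH` with the usual formula when `2 n + α + β + 1` is not zero. -/
theorem hahnH_eq (n : ℕ) (α β : ℝ) (N : ℕ) (hn : n ≤ N) (h0 : 2 * (n : ℝ) + α + β + 1 ≠ 0) :
    hahnH n α β N =
      poch ((n : ℝ) + α + β + 1) (N + 1) * poch (β + 1) n * (n ! : ℝ) /
        ((2 * (n : ℝ) + α + β + 1) * poch (α + 1) n * poch ((N : ℝ) - n + 1) n * (N ! : ℝ)) := by
  have e : N + 1 = n + (1 + (N - n)) := by omega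
  have e1 : poch ((n : ℝ) + α + β + 1 + n) 1 = 2 * (n : ℝ) + α + β + 1 := by
    simp [poch]; ring
  have e2 : (n : ℝ) + α + β + 1 + n + (1 : ℕ) = 2 * (n : ℝ) + α + β + 2 := by
    push_cast; ring
  rw [e, poch_add, poch_add, e1, e2]
  unfold hahnH
  have := mul_div_mul_left
    (poch ((n : ℝ) + α + β + 1) n * poch (2 * (n : ℝ) + α + β + 2) (N - n) * poch (β + 1) n * (n ! : ℝ))
    (poch (α + 1) n * poch ((N : ℝ) - n + 1) n * (N ! : ℝ)) h0
  rw [← this]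
  congr 1 <;> ring

/-- The orthonormal Hahn function `Q̃_n(x; α, β, N)`. -/
def hahnFun (n x : ℕ) (α β : ℝ) (N : ℕ) : ℝ :=
  √(hahnW x α β N) * hahnQ n (x : ℝ) α β N / √(hahnH n α β N)

/-- The Poisson kernel for dual Hahn polynomials. -/
def dualHahnPoissonKernel (t : ℝ) (k l : ℕ) (α β : ℝ) (j : ℕ) : ℝ :=
  ∑ n ∈ Finset.range (j + 1),
    t ^ n * (Ring.choose (α + (n : ℝ)) n * Ring.choose (β + (j : ℝ) - (n : ℝ)) (j - n)) *
      dualHahnR n (k : ℝ) α β j * dualHahnR n (l : ℝ) α β j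

/-- `S(k, l, α, j) = ∑_n (-1)^n w(n; α, α, j) Q_k(n; α, α, j) Q_l(n; α, α, j)`. -/
def kernelS (k l : ℕ) (α : ℝ) (j : ℕ) : ℝ :=
  ∑ n ∈ Finset.range (j + 1),
    (-1) ^ n * hahnW n α α j * hahnQ k (n : ℝ) α α j * hahnQ l (n : ℝ) α α j

/-- The distance `k` to the middle of the index `j ± k`. -/
def offs (j : ℕ) (c : Fin (2 * j + 1)) : ℕ := ((c : ℤ) - (j : ℤ)).natAbs

/-- The sign `±1` of an index `j ± k` with `k ≥ 1`, and `0` for the middle index `j`. -/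
def side (j : ℕ) (c : Fin (2 * j + 1)) : ℝ := (((c : ℤ) - (j : ℤ)).sign : ℝ)

/-- `1` for `k = 0` and `1 / √2` for `k ≥ 1`. -/
def colNorm (k : ℕ) : ℝ := if k = 0 then 1 else 1 / √2

/-- The matrix `U` whose columns are the orthonormal eigenvectors of the position operator. -/
def matU (α : ℝ) (j : ℕ) : Matrix (Fin (2 * j + 1)) (Fin (2 * j + 1)) ℝ := fun r c =>
  if Even (r : ℕ) then
    (-1) ^ ((r : ℕ) / 2) * colNorm (offs j c) * hahnFun (offs j c) ((r : ℕ) / 2) α α j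
  else if offs j c = 0 then 0
  else side j c * ((-1) ^ ((r : ℕ) / 2) / √2) *
    hahnFun (offs j c - 1) ((r : ℕ) / 2) (α + 1) (α + 1) (j - 1)

/-- The matrix `V` whose columns are the orthonormal eigenvectors of the momentum operator. -/
def matV (α : ℝ) (j : ℕ) : Matrix (Fin (2 * j + 1)) (Fin (2 * j + 1)) ℂ := fun r c =>
  -Complex.I ^ ((r : ℕ) + 1) * (matU α j r c : ℂ)

/-- The discrete Hahn-Fourier matrix `F = Uᵀ V`. -/
def hahnFourier (α : ℝ) (j : ℕ) : Matrix (Fin (2 * j + 1)) (Fin (2 * j + 1)) ℂ :=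
  ((matU α j).map fun x : ℝ => (x : ℂ)).transpose * matV α j

/-- The explicit Pochhammer prefactor, for `k + l + j` even; the three parity patterns of
`(k, l, j)` are `(2K, 2L, 2J)`, `(2K + 1, 2L + 1, 2J)` and `(2K, 2L + 1, 2J + 1)`, and
`(2K + 1, 2L, 2J + 1)` is the last one with `K` and `L` interchanged. -/
def kernelFactor (k l : ℕ) (α : ℝ) (j : ℕ) : ℝ :=
  let K := k / 2
  let L := l / 2
  let J := j / 2
  let mixed : ℕ → ℕ → ℝ := fun K L =>
    2 ^ (2 * J + 1) * poch (1 / 2) (J - K + 1) * poch (1 / 2) (J - L) * poch (α + 1) (J + 1) *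
      poch (α + J + 2) K * poch (α + J + 2) L / (((2 * J + 1)! : ℝ) * poch (1 / 2) (J + 1))
  if Even k then
    if Even l then
      2 ^ (2 * J) * poch (1 / 2) (J - K) * poch (1 / 2) (J - L) * poch (α + 1) J *
        poch (α + J + 1) K * poch (α + J + 1) L / (((2 * J)! : ℝ) * poch (1 / 2) J)
    else mixed K L
  else
    if Even l then mixed L K
    else
      2 ^ (2 * J) * poch (1 / 2) (J - K) * poch (1 / 2) (J - L) * poch (α + 1) (J + 1) *
        poch (α + J + 2) K * poch (α + J + 2) L / (((2 * J)! : ℝ) * J * poch (1 / 2) J)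

/-- The Racah polynomial that belongs to `(k, l, α, j)`, for `k + l + j` even. The truncation
parameter `N`, with `γ + 1 = -N`, is `J - 1` for the pattern `(2K + 1, 2L + 1, 2J)` and `J` for
all other patterns. -/
def kernelRacah (k l : ℕ) (α : ℝ) (j : ℕ) : ℝ :=
  let K := k / 2
  let L := l / 2
  let J := j / 2
  if Even k then
    if Even l then racahR K (L : ℝ) α (-1 / 2) (-(J : ℝ) - 1) (α + J + 1 / 2)
    else racahR K (L : ℝ) α (-1 / 2) (-(J : ℝ) - 1) (α + J + 3 / 2)
  else
    if Even l then racahR L (K : ℝ) α (-1 / 2) (-(J : ℝ) - 1) (α + J + 3 / 2)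
    else racahR K (L : ℝ) α (1 / 2) (-(J : ℝ)) (α + J + 1 / 2)

/-- The factor of the imaginary entries `F_{j ± k, j ± l}` (`k + l + j` even). -/
def imFactor (k l : ℕ) (α : ℝ) (j : ℕ) : ℝ :=
  colNorm k * colNorm l / √(hahnH k α α j * hahnH l α α j) * kernelFactor k l α j

/-- The factor of the real entries `F_{j ± k, j ± l}` (`k + l + j` odd and `k, l ≥ 1`),
without its sign. -/
def reFactor (k l : ℕ) (α : ℝ) (j : ℕ) : ℝ :=
  1 / (2 * √(hahnH (k - 1) (α + 1) (α + 1) (j - 1) * hahnH (l - 1) (α + 1) (α + 1) (j - 1))) *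
    kernelFactor (k - 1) (l - 1) (α + 1) (j - 1)

end

/-! For `β = α` the Hahn weight is symmetric under `n ↦ N - n`, and this symmetry makes quadratic
transformations available. A Hahn polynomial is the image of the Gegenbauer polynomial `₂F₁(-k, k +
2α + 1; α + 1; z)` under the functional `z ^ r ↦ (-x)_r / (-N)_r`. Writing the Gegenbauer polynomial
in powers of `4 z (1 - z)`, with an extra factor `1 - 2 z` in odd degree, expands `Q_k` in the
products `(-x)_m (x - N)_m`, with an extra factor `N - 2 x` in odd degree (`hahnQ_even`,
`hahnQ_odd`). Sheppard's transformation followed by the same argument gives a second expansion, in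
`(α + 1 + x)_p (α + 1 + N - x)_p` (`hahnQ_even_dual`, `hahnQ_odd_dual`).

In `S`, one polynomial is expanded in the first basis and the other in the second. Both kinds of
products are absorbed by the weight: the first shortens the interval to `N - 2 m`, both raise the
parameter to `α + m + p` (`sum_hahnW_poch`). What remains are the alternating moments `altSum s`
with `s = 0, 1, 2`, one power for each odd degree. They have closed forms because `(1 + t) ^ (-A -
1) (1 - t) ^ (-A - 1) = (1 - t ^ 2) ^ (-A - 1)`.

In the resulting double sum, `m` and `p` are coupled only through `(α + 1)_{m + p}`. Vandermonde
writes `(d)_{m + p} / ((d)_m (d)_p)` as `₂F₁(-m, -p; d; 1)`. After interchanging sums, the sums over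
`m` and `p` are again Vandermonde sums, and a single `₄F₃(1)` is left (`sum_sum_poch_add`).

For the matrix `F`, even rows contribute a multiple of `S(k, l, α, j)` and odd rows a multiple of
`S(k - 1, l - 1, α + 1, j - 1)`. The two parity sums differ by three, so at most one contribution
survives. -/

/-! ### Pochhammer symbols. -/

theorem poch_zero (a : ℝ) : poch a 0 = 1 := by simp [poch]

theorem poch_one (a : ℝ) : poch a 1 = a := by simp [poch]

theorem poch_succ (a : ℝ) (n : ℕ) : poch a (n + 1) = poch a n * (a + n) := by
  rw [poch_add, poch_one]

theorem poch_succ_left (a : ℝ) (n : ℕ) : poch a (n + 1) = a * poch (a + 1) n := by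
  rw [add_comm n, poch_add, poch_one, Nat.cast_one]

theorem poch_pos {a : ℝ} (ha : 0 < a) (n : ℕ) : 0 < poch a n := ascPochhammer_pos n a ha

theorem poch_ne_zero_of_le {a : ℝ} {m n : ℕ} (h : m ≤ n) (hn : poch a n ≠ 0) : poch a m ≠ 0 := by
  obtain ⟨t, rfl⟩ := Nat.exists_eq_add_of_le h
  rw [poch_add] at hn
  exact left_ne_zero_of_mul hn

theorem poch_neg_natCast (n r : ℕ) : poch (-(n : ℝ)) r = (-1) ^ r * ((r ! : ℝ) * n.choose r) := by
  induction r with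
  | zero => simp [poch_zero]
  | succ r ih =>
    have h : ((n.choose (r + 1) : ℕ) : ℝ) * (r + 1) = n.choose r * ((n : ℝ) - r) := by
      rcases le_or_gt r n with hr | hr
      · have := Nat.choose_succ_right_eq n r
        rw [← Nat.cast_sub hr]
        exact_mod_cast this
      · simp [Nat.choose_eq_zero_of_lt hr, Nat.choose_eq_zero_of_lt (Nat.lt_succ_of_lt hr)]
    rw [poch_succ, ih, Nat.factorial_succ]
    push_cast
    linear_combination (-1) ^ r * (r ! : ℝ) * h

theorem poch_neg_natCast_eq_zero {n r : ℕ} (h : n < r) : poch (-(n : ℝ)) r = 0 := by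
  simp [poch_neg_natCast, Nat.choose_eq_zero_of_lt h]

theorem poch_neg_natCast_ne_zero {n r : ℕ} (h : r ≤ n) : poch (-(n : ℝ)) r ≠ 0 := by
  have := (Nat.choose_pos h).ne'
  rw [poch_neg_natCast]
  positivity

theorem poch_neg_natCast_mul_factorial {n r : ℕ} (h : r ≤ n) :
    poch (-(n : ℝ)) r * ((n - r)! : ℝ) = (-1) ^ r * (n ! : ℝ) := by
  rw [poch_neg_natCast, ← Nat.choose_mul_factorial_mul_factorial h]
  push_cast
  ring

theorem poch_two_mul (c : ℝ) (m : ℕ) :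
    poch c (2 * m) = 4 ^ m * poch (c / 2) m * poch ((c + 1) / 2) m := by
  induction m with
  | zero => simp [poch_zero]
  | succ m ih =>
    rw [show 2 * (m + 1) = 2 * m + 1 + 1 by ring, poch_succ, poch_succ, ih, poch_succ, poch_succ]
    push_cast
    ring

theorem poch_reflect (e : ℝ) (n : ℕ) : poch (1 - e - n) n = (-1) ^ n * poch e n := by
  induction n with
  | zero => simp [poch_zero]
  | succ n ih =>
    rw [poch_succ_left, poch_succ, pow_succ]
    have : (1 - e - ((n + 1 : ℕ) : ℝ) + 1) = 1 - e - n := by push_cast; ring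
    rw [this, ih]
    push_cast
    ring

/-! ### Chu–Vandermonde sums, Sheppard's transformation, and decoupling of double sums. -/

/-- The Chu–Vandermonde identity in polynomial form. -/
theorem sum_choose_mul_poch (n : ℕ) (b c : ℝ) :
    ∑ r ∈ Finset.range (n + 1), (n.choose r : ℝ) * ((-1) ^ r * poch b r * poch (c + r) (n - r)) =
      poch (c - b) n := by
  induction n generalizing b c with
  | zero => simp [poch_zero]
  | succ n ih =>
    -- Pascal's rule splits the sum into one with `(b, c)` and one with `(b + 1, c + 1)`; both have
    -- the same difference `c - b`.
    rw [Finset.sum_choose_succ_mul (fun r s => (-1) ^ r * poch b r * poch (c + r) s) n]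
    have h1 : ∑ r ∈ Finset.range (n + 1), (n.choose r : ℝ) *
        ((-1) ^ r * poch b r * poch (c + r) (n + 1 - r)) = (c + n) * poch (c - b) n := by
      rw [← ih b c, Finset.mul_sum]
      refine Finset.sum_congr rfl fun r hr => ?_
      have hr' : r ≤ n := Nat.lt_succ_iff.mp (Finset.mem_range.mp hr)
      rw [show n + 1 - r = (n - r) + 1 by omega, poch_succ, Nat.cast_sub hr']
      ring
    have h2 : ∑ r ∈ Finset.range (n + 1), (n.choose r : ℝ) *
        ((-1) ^ (r + 1) * poch b (r + 1) * poch (c + ((r + 1 : ℕ) : ℝ)) (n - r)) =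
        -b * poch (c - b) n := by
      rw [show c - b = (c + 1) - (b + 1) by ring, ← ih (b + 1) (c + 1), Finset.mul_sum]
      refine Finset.sum_congr rfl fun r _ => ?_
      rw [poch_succ_left, show c + ((r + 1 : ℕ) : ℝ) = c + 1 + r by push_cast; ring]
      ring
    rw [h1, h2, poch_succ]
    ring

/-- The Chu–Vandermonde sum `₂F₁(-m, b; d; 1)`. -/
theorem sum_vandermonde {m M : ℕ} (hm : m ≤ M) (b : ℝ) {d : ℝ} (hd : ∀ n, poch d n ≠ 0) :
    ∑ i ∈ Finset.range (M + 1), poch (-(m : ℝ)) i * poch b i / (poch d i * (i ! : ℝ)) =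
      poch (d - b) m / poch d m := by
  have hsub : Finset.range (m + 1) ⊆ Finset.range (M + 1) :=
    Finset.range_subset_range.mpr (by omega)
  rw [← Finset.sum_subset hsub]
  · rw [← sum_choose_mul_poch, Finset.sum_div]
    refine Finset.sum_congr rfl fun i hi => ?_
    have hi' : i ≤ m := Nat.lt_succ_iff.mp (Finset.mem_range.mp hi)
    have e : poch d m = poch d i * poch (d + i) (m - i) := by
      rw [← poch_add, Nat.add_sub_cancel' hi']
    have := hd i
    have h3 := hd m
    have h4 : poch (d + i) (m - i) ≠ 0 := by
      rw [e] at h3; exact right_ne_zero_of_mul h3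
    have := Nat.factorial_ne_zero i
    rw [poch_neg_natCast, e]
    field_simp
  · intro i _ hi
    rw [poch_neg_natCast_eq_zero (by simpa using hi)]
    simp

/-- A Chu–Vandermonde sum with a shifted index of summation. -/
theorem sum_vandermonde_shift (k i : ℕ) {a e f : ℝ} (h : e + f + k = 1 + a)
    (hf : poch f k ≠ 0) (he : poch e k ≠ 0) :
    ∑ m ∈ Finset.range (k + 1),
        poch (-(m : ℝ)) i * (poch (-(k : ℝ)) m * poch a m / (poch f m * (m ! : ℝ))) =
      (-1) ^ k * poch e k / poch f k * (poch (-(k : ℝ)) i * poch a i / poch e i) := by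
  rcases lt_or_ge k i with hki | hki
  · rw [poch_neg_natCast_eq_zero hki]
    rw [Finset.sum_eq_zero]
    · simp
    · intro m hm
      rw [poch_neg_natCast_eq_zero (by have := Finset.mem_range.mp hm; omega), zero_mul]
  · obtain ⟨t, rfl⟩ := Nat.exists_eq_add_of_le hki
    rw [show i + t + 1 = i + (t + 1) by ring, Finset.sum_range_add, Finset.sum_eq_zero, zero_add]
    swap
    · intro m hm
      rw [poch_neg_natCast_eq_zero (Finset.mem_range.mp hm), zero_mul]
    -- With `m = i + s` the sum over `s` is a Vandermonde sum. The balance condition turns its value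
    -- `(f - a)_t` into `(1 - (e + i) - t)_t`, which reflection turns into `(e + i)_t` up to sign.
    have hV := sum_choose_mul_poch t (a + i) (f + i)
    have e1 : f + i - (a + i) = 1 - (e + i) - t := by push_cast at h; linarith
    rw [e1, poch_reflect] at hV
    have hei : poch e i ≠ 0 := poch_ne_zero_of_le (Nat.le_add_right i t) he
    have e2 : (-1 : ℝ) ^ (i + t) * poch e (i + t) / poch f (i + t) *
        (poch (-((i + t : ℕ) : ℝ)) i * poch a i / poch e i) =
        (-1) ^ i * poch (-((i + t : ℕ) : ℝ)) i * poch a i / poch f (i + t) *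
          ((-1) ^ t * poch (e + i) t) := by
      rw [poch_add e, pow_add]
      field_simp
    rw [e2, ← hV, Finset.mul_sum]
    refine Finset.sum_congr rfl fun s hs => ?_
    have hs' : s ≤ t := Nat.lt_succ_iff.mp (Finset.mem_range.mp hs)
    have e3 : poch f (i + t) = poch f (i + s) * poch (f + i + s) (t - s) := by
      rw [show i + t = (i + s) + (t - s) by omega, poch_add]
      push_cast
      rw [add_assoc]
    have h3 : poch f (i + s) ≠ 0 := poch_ne_zero_of_le (by omega) hf
    have h4 : poch (f + i + s) (t - s) ≠ 0 := by
      rw [e3] at hf; exact right_ne_zero_of_mul hf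
    have hc : (((i + t).choose (i + s) : ℕ) : ℝ) * ((i + s).choose i : ℕ) =
        ((i + t).choose i : ℕ) * (t.choose s : ℕ) := by
      have := Nat.choose_mul (n := i + t) (k := i + s) (s := i) (by omega)
      rw [show i + t - i = t by omega, show i + s - i = s by omega] at this
      exact_mod_cast this
    have hfac := Nat.factorial_ne_zero (i + s)
    rw [e3, poch_neg_natCast, poch_neg_natCast, poch_neg_natCast, poch_add a]
    field_simp
    rw [pow_add]
    linear_combination (poch a i * poch (a + i) s * (-1) ^ i * (-1) ^ s) * hc

/-- Sheppard's transformation of a terminating `₃F₂(1)`. -/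
theorem sum_sheppard (k : ℕ) (b : ℝ) {a d e f : ℝ} (h : e + f + k = 1 + a)
    (hd : ∀ n, poch d n ≠ 0) (hf : poch f k ≠ 0) (he : poch e k ≠ 0) :
    ∑ m ∈ Finset.range (k + 1),
        poch (-(k : ℝ)) m * poch a m * poch (d - b) m / (poch d m * poch f m * (m ! : ℝ)) =
      (-1) ^ k * poch e k / poch f k * ∑ i ∈ Finset.range (k + 1),
        poch (-(k : ℝ)) i * poch a i * poch b i / (poch d i * poch e i * (i ! : ℝ)) := by
  -- The quotient `(d - b)_m / (d)_m` is expanded as `₂F₁(-m, b; d; 1)`, so that the sum over `m`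
  -- can be done first.
  have h1 : ∀ m ∈ Finset.range (k + 1),
      poch (-(k : ℝ)) m * poch a m * poch (d - b) m / (poch d m * poch f m * (m ! : ℝ)) =
      ∑ i ∈ Finset.range (k + 1), poch b i / (poch d i * (i ! : ℝ)) *
        (poch (-(m : ℝ)) i * (poch (-(k : ℝ)) m * poch a m / (poch f m * (m ! : ℝ)))) := by
    intro m hm
    have hm' : m ≤ k := Nat.lt_succ_iff.mp (Finset.mem_range.mp hm)
    have := sum_vandermonde hm' b hd
    have e1 : poch (-(k : ℝ)) m * poch a m * poch (d - b) m / (poch d m * poch f m * (m ! : ℝ)) =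
        (poch (-(k : ℝ)) m * poch a m / (poch f m * (m ! : ℝ))) * (poch (d - b) m / poch d m) := by
      simp only [div_eq_mul_inv, mul_inv]
      ring
    rw [e1, ← this, Finset.mul_sum]
    refine Finset.sum_congr rfl fun i _ => ?_
    simp only [div_eq_mul_inv, mul_inv]
    ring
  rw [Finset.sum_congr rfl h1, Finset.sum_comm, Finset.mul_sum]
  refine Finset.sum_congr rfl fun i _ => ?_
  rw [← Finset.mul_sum, sum_vandermonde_shift k i h hf he]
  simp only [div_eq_mul_inv, mul_inv]
  ring

/-- Two terminating series coupled by `(d)_{m + p}` reduce to a single `₄F₃(1)`. -/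
theorem sum_sum_poch_add (K L : ℕ) {a a' d e e' f f' : ℝ} (h : e + f + K = 1 + a)
    (h' : e' + f' + L = 1 + a') (hd : ∀ n, poch d n ≠ 0) (hf : poch f K ≠ 0) (he : poch e K ≠ 0)
    (hf' : poch f' L ≠ 0) (he' : poch e' L ≠ 0) :
    ∑ m ∈ Finset.range (K + 1), ∑ p ∈ Finset.range (L + 1),
        (poch (-(K : ℝ)) m * poch a m / (poch f m * (m ! : ℝ))) *
        (poch (-(L : ℝ)) p * poch a' p / (poch f' p * (p ! : ℝ))) *
        (poch d (m + p) / (poch d m * poch d p)) =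
      (-1) ^ K * poch e K / poch f K * ((-1) ^ L * poch e' L / poch f' L) *
        ∑ i ∈ Finset.range (K + 1),
          poch (-(K : ℝ)) i * poch a i * poch (-(L : ℝ)) i * poch a' i /
            (poch d i * poch e i * poch e' i * (i ! : ℝ)) := by
  have h1 : ∀ m ∈ Finset.range (K + 1), ∀ p ∈ Finset.range (L + 1),
      (poch (-(K : ℝ)) m * poch a m / (poch f m * (m ! : ℝ))) *
        (poch (-(L : ℝ)) p * poch a' p / (poch f' p * (p ! : ℝ))) *
        (poch d (m + p) / (poch d m * poch d p)) =
      ∑ i ∈ Finset.range (K + 1), 1 / (poch d i * (i ! : ℝ)) *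
        ((poch (-(m : ℝ)) i * (poch (-(K : ℝ)) m * poch a m / (poch f m * (m ! : ℝ)))) *
        (poch (-(p : ℝ)) i * (poch (-(L : ℝ)) p * poch a' p / (poch f' p * (p ! : ℝ))))) := by
    intro m hm p _
    have hm' : m ≤ K := Nat.lt_succ_iff.mp (Finset.mem_range.mp hm)
    have hV := sum_vandermonde hm' (-(p : ℝ)) hd
    -- The coupling equals `(d + p)_m / (d)_m`, the value of `₂F₁(-m, -p; d; 1)`; in that expansion
    -- `m` and `p` occur in separate factors.
    have e1 : poch d (m + p) / (poch d m * poch d p) = poch (d - -(p : ℝ)) m / poch d m := by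
      rw [add_comm m p, poch_add, sub_neg_eq_add]
      have := hd m
      have := hd p
      field_simp
    rw [e1, ← hV, Finset.mul_sum]
    refine Finset.sum_congr rfl fun i _ => ?_
    simp only [div_eq_mul_inv, mul_inv]
    ring
  rw [Finset.sum_congr rfl fun m hm => Finset.sum_congr rfl (h1 m hm)]
  simp_rw [Finset.sum_comm (s := Finset.range (L + 1))]
  rw [Finset.sum_comm, Finset.mul_sum]
  refine Finset.sum_congr rfl fun i _ => ?_
  simp_rw [← Finset.mul_sum]
  rw [← Finset.sum_mul, sum_vandermonde_shift K i h hf he, sum_vandermonde_shift L i h' hf' he']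
  simp only [div_eq_mul_inv, mul_inv]
  ring

/-! ### The hypergeometric differential equation and quadratic transformations of `₂F₁`. -/

open Polynomial in
theorem coeff_X_mul_derivative (p : ℝ[X]) (n : ℕ) :
    (X * derivative p).coeff n = n * p.coeff n := by
  cases n with
  | zero => simp
  | succ n => rw [coeff_X_mul, coeff_derivative]; push_cast; ring

open Polynomial in
/-- The hypergeometric differential equation in terms of coefficients. -/
theorem hypergeometric_ode_iff (a b c : ℝ) (y : ℝ[X]) :
    X * (1 - X) * derivative (derivative y) + (C c - C (a + b + 1) * X) * derivative y -
      C (a * b) * y = 0 ↔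
    ∀ n : ℕ, (n + 1) * (c + n) * y.coeff (n + 1) = (a + n) * (b + n) * y.coeff n := by
  -- With `θ = X d/dX` the operator is `d/dX (θ + c - 1) - (θ + a) (θ + b)`, and `θ` multiplies the
  -- `n`-th coefficient by `n`.
  have e : X * (1 - X) * derivative (derivative y) + (C c - C (a + b + 1) * X) * derivative y -
      C (a * b) * y = derivative (X * derivative y + C (c - 1) * y) -
      (X * derivative (X * derivative y) + C (a + b) * (X * derivative y) + C (a * b) * y) := by
    simp only [derivative_add, derivative_mul, derivative_X, derivative_C]
    simp only [C_add, C_sub, C_mul, C_1]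
    ring
  rw [e, sub_eq_zero, Polynomial.ext_iff]
  refine forall_congr' fun n => ?_
  simp only [coeff_derivative, coeff_add, coeff_C_mul, coeff_X_mul_derivative]
  push_cast
  constructor <;> intro h <;> linear_combination h

open Polynomial in
/-- The polynomial `₂F₁(-n, b; c; z)`. -/
noncomputable def hypPoly (n : ℕ) (b c : ℝ) : ℝ[X] :=
  ∑ r ∈ Finset.range (n + 1),
    C (poch (-(n : ℝ)) r * poch b r / (poch c r * (r ! : ℝ))) * X ^ r

open Polynomial in
theorem coeff_hypPoly (n : ℕ) (b c : ℝ) (r : ℕ) :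
    (hypPoly n b c).coeff r = poch (-(n : ℝ)) r * poch b r / (poch c r * (r ! : ℝ)) := by
  simp only [hypPoly, finsetSum_coeff, coeff_C_mul_X_pow]
  rw [Finset.sum_ite_eq]
  split_ifs with h
  · rfl
  · rw [poch_neg_natCast_eq_zero (by simpa using h)]
    simp

theorem coeff_hypPoly_zero (n : ℕ) (b c : ℝ) : (hypPoly n b c).coeff 0 = 1 := by
  simp [coeff_hypPoly, poch_zero]

theorem coeff_hypPoly_succ (n : ℕ) (b : ℝ) {c : ℝ} (hc : ∀ n, poch c n ≠ 0) (r : ℕ) :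
    (r + 1) * (c + r) * (hypPoly n b c).coeff (r + 1) =
      (-(n : ℝ) + r) * (b + r) * (hypPoly n b c).coeff r := by
  have h2 := hc (r + 1)
  have h3 := hc r
  rw [poch_succ] at h2
  have h4 : c + r ≠ 0 := right_ne_zero_of_mul h2
  have h5 : (r : ℝ) + 1 ≠ 0 := by positivity
  have h6 := Nat.factorial_ne_zero r
  rw [coeff_hypPoly, coeff_hypPoly, poch_succ, poch_succ, poch_succ, Nat.factorial_succ]
  push_cast
  field_simp

open Polynomial in
-- The equation is a two-term recurrence whose leading factor `(r + 1) (c + r)` never vanishes, so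
-- the constant coefficient determines the polynomial.
theorem eq_hypPoly_of_ode {n : ℕ} {b c : ℝ} {y : ℝ[X]} (hc : ∀ n, poch c n ≠ 0)
    (hy : X * (1 - X) * derivative (derivative y) +
      (C c - C (-(n : ℝ) + b + 1) * X) * derivative y - C (-(n : ℝ) * b) * y = 0)
    (h0 : y.coeff 0 = 1) : y = hypPoly n b c := by
  rw [hypergeometric_ode_iff] at hy
  ext r
  induction r with
  | zero => rw [h0, coeff_hypPoly_zero]
  | succ r ih =>
    have h2 := hc (r + 1)
    rw [poch_succ] at h2
    have h4 : c + r ≠ 0 := right_ne_zero_of_mul h2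
    have h5 : (r : ℝ) + 1 ≠ 0 := by positivity
    apply mul_left_cancel₀ (mul_ne_zero h5 h4)
    rw [hy r, coeff_hypPoly_succ n b hc r, ih]

open Polynomial in
/-- The quadratic transformation of `₂F₁` for Gegenbauer polynomials of even degree. -/
theorem hypPoly_even (K : ℕ) {α : ℝ} (hc : ∀ n, poch (α + 1) n ≠ 0) :
    (hypPoly K (K + α + 1 / 2) (α + 1)).comp (C 4 * X * (1 - X)) =
      hypPoly (2 * K) ((2 * K : ℕ) + 2 * α + 1) (α + 1) := by
  have hg := (hypergeometric_ode_iff _ _ _ _).mpr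
    (coeff_hypPoly_succ K (K + α + 1 / 2) hc)
  have h0 := coeff_hypPoly_zero K (K + α + 1 / 2) (α + 1)
  generalize hypPoly K (K + α + 1 / 2) (α + 1) = g at *
  have hw := congrArg (fun p => p.comp (C 4 * X * (1 - X))) hg
  -- The constant `C (1 / 2)` is opaque to `ring`, hence this relation.
  have h2 : (C (1 / 2) : ℝ[X]) * 2 = 1 := by
    rw [← map_ofNat C 2, ← C_mul, ← C_1]; norm_num
  apply eq_hypPoly_of_ode hc
  · simp only [derivative_comp, derivative_mul, derivative_X, derivative_C, derivative_sub,
      derivative_add, derivative_one, derivative_zero, add_comp, sub_comp, mul_comp, X_comp, C_comp, one_comp, zero_comp] at hw ⊢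
    generalize (derivative (derivative g)).comp _ = g2 at *
    generalize (derivative g).comp _ = g1 at *
    generalize g.comp _ = g0 at *
    push_cast
    simp only [C_add, C_mul, C_neg, C_1, map_ofNat, C_eq_natCast] at hw ⊢
    -- With `w = 4 z (1 - z)` one has `(1 - 2 z) ^ 2 = 1 - w`, so the pulled-back equation for `g`,
    -- times 4, is the equation sought.
    linear_combination 4 * hw + (2 * (4 * X * (1 - X)) * g1 - 2 * K * g0) * h2
  · rw [coeff_zero_eq_eval_zero, eval_comp]
    simpa [← coeff_zero_eq_eval_zero] using h0

open Polynomial in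
/-- The quadratic transformation of `₂F₁` for Gegenbauer polynomials of odd degree. -/
theorem hypPoly_odd (K : ℕ) {α : ℝ} (hc : ∀ n, poch (α + 1) n ≠ 0) :
    (1 - C 2 * X) * (hypPoly K (K + α + 3 / 2) (α + 1)).comp (C 4 * X * (1 - X)) =
      hypPoly (2 * K + 1) ((2 * K + 1 : ℕ) + 2 * α + 1) (α + 1) := by
  have hg := (hypergeometric_ode_iff _ _ _ _).mpr
    (coeff_hypPoly_succ K (K + α + 3 / 2) hc)
  have h0 := coeff_hypPoly_zero K (K + α + 3 / 2) (α + 1)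
  generalize hypPoly K (K + α + 3 / 2) (α + 1) = g at *
  have hw := congrArg (fun p => p.comp (C 4 * X * (1 - X))) hg
  have h2 : (C (3 / 2) : ℝ[X]) * 2 = 3 := by
    rw [← map_ofNat C 2, ← C_mul, ← map_ofNat C 3]; norm_num
  apply eq_hypPoly_of_ode hc
  · simp only [derivative_comp, derivative_mul, derivative_X, derivative_C, derivative_sub,
      derivative_add, derivative_one, derivative_zero, add_comp, sub_comp, mul_comp, X_comp,
      C_comp, one_comp, zero_comp] at hw ⊢
    generalize (derivative (derivative g)).comp _ = g2 at *
    generalize (derivative g).comp _ = g1 at *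
    generalize g.comp _ = g0 at *
    push_cast
    simp only [C_add, C_mul, C_neg, C_1, map_ofNat, C_eq_natCast] at hw ⊢
    linear_combination 4 * (1 - 2 * X) * hw +
      (1 - 2 * X) * (2 * (4 * X * (1 - X)) * g1 - 2 * K * g0) * h2
  · rw [coeff_zero_eq_eval_zero, eval_mul, eval_comp]
    simpa [← coeff_zero_eq_eval_zero] using h0

/-! ### Quadratic transformations of `₃F₂(1)` through a moment functional. -/

open Polynomial in
/-- The linear functional with `z ^ r ↦ (b)_r / (c)_r`. -/
noncomputable def pochFunctional (b c : ℝ) : ℝ[X] →ₗ[ℝ] ℝ :=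
  Polynomial.lsum fun r => (poch b r / poch c r) • LinearMap.id

open Polynomial in
theorem pochFunctional_C_mul_X_pow (b c u : ℝ) (r : ℕ) :
    pochFunctional b c (C u * X ^ r) = u * (poch b r / poch c r) := by
  rw [C_mul_X_pow_eq_monomial, pochFunctional, Polynomial.lsum_apply, sum_monomial_index]
  · simp [mul_comm]
  · simp

open Polynomial in
theorem pochFunctional_C_mul (b c u : ℝ) (p : ℝ[X]) :
    pochFunctional b c (C u * p) = u * pochFunctional b c p := by
  rw [← smul_eq_C_mul, map_smul, smul_eq_mul]

open Polynomial in
-- For `0 < b < c` the functional is the expectation under the beta distribution with parameters `b`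
-- and `c - b`, and this is its mixed moment. It makes powers of `z (1 - z)` map to products.
theorem pochFunctional_X_pow_mul (b c : ℝ) (i j : ℕ) (hc : poch c (i + j) ≠ 0) :
    pochFunctional b c (X ^ i * (1 - X) ^ j) =
      poch b i * poch (c - b) j / poch c (i + j) := by
  induction j generalizing i with
  | zero =>
    have := pochFunctional_C_mul_X_pow b c 1 i
    simpa [poch_zero] using this
  | succ j ih =>
    have e : (X : ℝ[X]) ^ i * (1 - X) ^ (j + 1) =
        X ^ i * (1 - X) ^ j - X ^ (i + 1) * (1 - X) ^ j := by ring
    rw [e, map_sub, ih i (poch_ne_zero_of_le (by omega) hc),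
      ih (i + 1) (by rwa [add_right_comm, add_assoc]), show i + 1 + j = i + j + 1 by ring,
      ← add_assoc]
    have h1 : poch c (i + j + 1) ≠ 0 := by rwa [← add_assoc] at hc
    rw [poch_succ c] at h1 ⊢
    have h2 := left_ne_zero_of_mul h1
    have h3 := right_ne_zero_of_mul h1
    rw [poch_succ, poch_succ]
    field_simp
    push_cast
    ring

theorem pochFunctional_hypPoly (n : ℕ) (a b c d : ℝ) :
    pochFunctional b c (hypPoly n a d) = ∑ r ∈ Finset.range (n + 1),
      poch (-(n : ℝ)) r * poch a r * poch b r / (poch d r * poch c r * (r ! : ℝ)) := by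
  simp only [hypPoly, map_sum, pochFunctional_C_mul_X_pow]
  refine Finset.sum_congr rfl fun r _ => ?_
  simp only [div_eq_mul_inv, mul_inv]
  ring

/-- A quadratic transformation of a terminating `₃F₂(1)` of even degree. -/
theorem sum_quadratic_even (K : ℕ) {α : ℝ} (hd : ∀ n, poch (α + 1) n ≠ 0) (b : ℝ) {c : ℝ}
    (hc : poch c (2 * K) ≠ 0) :
    ∑ r ∈ Finset.range (2 * K + 1),
        poch (-((2 * K : ℕ) : ℝ)) r * poch ((2 * K : ℕ) + 2 * α + 1) r * poch b r /
          (poch (α + 1) r * poch c r * (r ! : ℝ)) =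
      ∑ m ∈ Finset.range (K + 1),
        poch (-(K : ℝ)) m * poch (K + α + 1 / 2) m / (poch (α + 1) m * (m ! : ℝ)) *
          (4 ^ m * (poch b m * poch (c - b) m / poch c (2 * m))) := by
  rw [← pochFunctional_hypPoly, ← hypPoly_even K hd]
  simp only [hypPoly, Polynomial.sum_comp, map_sum]
  refine Finset.sum_congr rfl fun m hm => ?_
  have hm' : m ≤ K := Nat.lt_succ_iff.mp (Finset.mem_range.mp hm)
  have := pochFunctional_X_pow_mul b c m m (poch_ne_zero_of_le (by omega) hc)
  rw [← two_mul] at this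
  rw [← this, ← mul_assoc, ← pochFunctional_C_mul]
  congr 1
  simp only [Polynomial.mul_comp, Polynomial.C_comp, Polynomial.pow_comp, Polynomial.X_comp,
    mul_pow, Polynomial.C_mul, Polynomial.C_pow]
  ring

/-- A quadratic transformation of a terminating `₃F₂(1)` of odd degree. -/
theorem sum_quadratic_odd (K : ℕ) {α : ℝ} (hd : ∀ n, poch (α + 1) n ≠ 0) (b : ℝ) {c : ℝ}
    (hc : poch c (2 * K + 1) ≠ 0) :
    ∑ r ∈ Finset.range (2 * K + 1 + 1),
        poch (-((2 * K + 1 : ℕ) : ℝ)) r * poch ((2 * K + 1 : ℕ) + 2 * α + 1) r * poch b r /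
          (poch (α + 1) r * poch c r * (r ! : ℝ)) =
      (c - 2 * b) * ∑ m ∈ Finset.range (K + 1),
        poch (-(K : ℝ)) m * poch (K + α + 3 / 2) m / (poch (α + 1) m * (m ! : ℝ)) *
          (4 ^ m * (poch b m * poch (c - b) m / poch c (2 * m + 1))) := by
  rw [← pochFunctional_hypPoly, ← hypPoly_odd K hd]
  simp only [hypPoly, Polynomial.sum_comp, Finset.mul_sum, map_sum]
  refine Finset.sum_congr rfl fun m hm => ?_
  have hm' : m ≤ K := Nat.lt_succ_iff.mp (Finset.mem_range.mp hm)
  have hc1 : poch c (2 * m + 1) ≠ 0 := poch_ne_zero_of_le (by omega) hc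
  have h1 := pochFunctional_X_pow_mul b c m m
    (poch_ne_zero_of_le (by omega) hc)
  have h2 := pochFunctional_X_pow_mul b c (m + 1) m (by rwa [show m + 1 + m = 2 * m + 1 by ring])
  rw [← two_mul] at h1
  rw [show m + 1 + m = 2 * m + 1 by ring] at h2
  -- The factor `1 - 2 z` contributes `1 - 2 (b + m) / (c + 2 m) = (c - 2 b) / (c + 2 m)`, so `c - 2
  -- b` does not depend on `m`.
  have h3 : (c - 2 * b) * (poch b m * poch (c - b) m / poch c (2 * m + 1)) =
      pochFunctional b c (Polynomial.X ^ m * (1 - Polynomial.X) ^ m) -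
      2 * pochFunctional b c (Polynomial.X ^ (m + 1) * (1 - Polynomial.X) ^ m) := by
    rw [h1, h2]
    rw [poch_succ c] at hc1 ⊢
    have := left_ne_zero_of_mul hc1
    have := right_ne_zero_of_mul hc1
    rw [poch_succ]
    field_simp
    push_cast
    ring
  have h4 : ∀ u v w : ℝ, (c - 2 * b) * (u * (v * w)) = u * v * ((c - 2 * b) * w) := by
    intros; ring
  rw [h4, h3, ← pochFunctional_C_mul, ← map_sub, ← pochFunctional_C_mul]
  congr 1
  simp only [Polynomial.mul_comp, Polynomial.C_comp, Polynomial.pow_comp, Polynomial.X_comp,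
    mul_pow, Polynomial.C_mul, Polynomial.C_pow]
  ring

/-! ### Alternating convolutions of negative binomial coefficients. -/

/-- The coefficients `(A + 1)_n / n!` of `(1 - t) ^ (-A - 1)`. -/
noncomputable def negBinom (A : ℝ) (n : ℕ) : ℝ := poch (A + 1) n / (n ! : ℝ)

theorem choose_add_natCast (A : ℝ) (n : ℕ) : Ring.choose (A + n) n = negBinom A n := by
  have h := Ring.factorial_nsmul_multichoose_eq_ascPochhammer (A + 1) n
  rw [Polynomial.ascPochhammer_smeval_eq_eval, Ring.multichoose_eq, nsmul_eq_mul] at h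
  rw [negBinom, poch, ← h, show A + 1 + (n : ℝ) - 1 = A + n by ring]
  have := Nat.factorial_ne_zero n
  field_simp

theorem hahnW_eq (x : ℕ) (α : ℝ) {N : ℕ} (h : x ≤ N) :
    hahnW x α α N = negBinom α x * negBinom α (N - x) := by
  rw [hahnW, choose_add_natCast, show (N : ℝ) + α - x = α + ((N - x : ℕ) : ℝ) by
    rw [Nat.cast_sub h]; ring, choose_add_natCast]

theorem negBinom_zero (A : ℝ) : negBinom A 0 = 1 := by simp [negBinom, poch_zero]

theorem succ_mul_negBinom_succ (A : ℝ) (n : ℕ) :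
    (n + 1) * negBinom A (n + 1) = (A + 1) * negBinom (A + 1) n := by
  have := Nat.factorial_ne_zero n
  have : (n : ℝ) + 1 ≠ 0 := by positivity
  rw [negBinom, negBinom, poch_succ_left, Nat.factorial_succ]
  push_cast
  field_simp

theorem succ_mul_negBinom_succ' (A : ℝ) (n : ℕ) :
    (n + 1) * negBinom A (n + 1) = (A + 1 + n) * negBinom A n := by
  have := Nat.factorial_ne_zero n
  have : (n : ℝ) + 1 ≠ 0 := by positivity
  rw [negBinom, negBinom, poch_succ, Nat.factorial_succ]
  push_cast
  field_simp

/-- The sum `∑ (-1)^x (M - 2x)^s (A + 1)_x (A + 1)_{M - x} / (x! (M - x)!)`. -/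
noncomputable def altSum (s : ℕ) (A : ℝ) (M : ℕ) : ℝ :=
  ∑ x ∈ Finset.HasAntidiagonal.antidiagonal M,
    (-1) ^ x.1 * ((x.2 : ℝ) - x.1) ^ s * (negBinom A x.1 * negBinom A x.2)

open PowerSeries in
theorem altSum_zero_eq_coeff (A : ℝ) (M : ℕ) :
    altSum 0 A M = coeff M (mk (fun n => (-1) ^ n * negBinom A n) * mk (negBinom A)) := by
  rw [coeff_mul, altSum]
  refine Finset.sum_congr rfl fun x _ => ?_
  rw [coeff_mk, coeff_mk]
  ring

open PowerSeries in
-- The generating function `F = (1 - X ^ 2) ^ (-A - 1)` satisfies `(1 - X ^ 2) F' = 2 (A + 1) X F`.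
-- This is obtained from the first-order equations of the two factors and read off at the
-- coefficient of `X ^ (M + 1)`.
theorem altSum_zero_rec (A : ℝ) (M : ℕ) :
    (M + 2) * altSum 0 A (M + 2) = (M + 2 * (A + 1)) * altSum 0 A M := by
  set f : ℝ⟦X⟧ := mk fun n => (-1) ^ n * negBinom A n with hf
  set g : ℝ⟦X⟧ := mk (negBinom A) with hg
  have hgd : derivative ℝ g = X * derivative ℝ g + C (A + 1) * g := by
    ext n
    rw [map_add, coeff_C_mul, coeff_derivative]
    cases n with
    | zero =>
      have := succ_mul_negBinom_succ' A 0
      simp only [coeff_zero_X_mul, hg, coeff_mk]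
      push_cast at this ⊢
      linear_combination this
    | succ n =>
      have := succ_mul_negBinom_succ' A (n + 1)
      rw [coeff_succ_X_mul, coeff_derivative]
      simp only [hg, coeff_mk]
      push_cast at this ⊢
      linear_combination this
  have hfd : derivative ℝ f = -(X * derivative ℝ f) - C (A + 1) * f := by
    ext n
    rw [map_sub, map_neg, coeff_C_mul, coeff_derivative]
    cases n with
    | zero =>
      have := succ_mul_negBinom_succ' A 0
      simp only [coeff_zero_X_mul, hf, coeff_mk]
      push_cast at this ⊢
      linear_combination -this
    | succ n =>
      have := succ_mul_negBinom_succ' A (n + 1)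
      rw [coeff_succ_X_mul, coeff_derivative]
      simp only [hf, coeff_mk]
      push_cast at this ⊢
      linear_combination (-1) ^ n * this
  have hF : derivative ℝ (f * g) =
      X * (X * derivative ℝ (f * g)) + X * (C (2 * (A + 1)) * (f * g)) := by
    rw [Derivation.leibniz, smul_eq_mul, smul_eq_mul, map_mul C, map_ofNat]
    linear_combination (1 + X) * f * hgd + (1 - X) * g * hfd
  have h := congrArg (coeff (M + 1)) hF
  rw [map_add, coeff_succ_X_mul, coeff_succ_X_mul, coeff_C_mul, coeff_derivative,
    ← altSum_zero_eq_coeff, ← altSum_zero_eq_coeff] at h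
  have h2 : coeff M (X * derivative ℝ (f * g)) = M * altSum 0 A M := by
    cases M with
    | zero => simp
    | succ n =>
      rw [coeff_succ_X_mul, coeff_derivative, ← altSum_zero_eq_coeff]
      push_cast
      ring
  rw [h2] at h
  push_cast at h
  linear_combination h

theorem altSum_zero_even (A : ℝ) (J : ℕ) : altSum 0 A (2 * J) = poch (A + 1) J / (J ! : ℝ) := by
  induction J with
  | zero => simp [altSum, negBinom_zero, poch_zero]
  | succ J ih =>
    have h := altSum_zero_rec A (2 * J)
    have h1 := Nat.factorial_ne_zero J
    have h2 : (J : ℝ) + 1 ≠ 0 := by positivity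
    rw [ih] at h
    rw [show 2 * (J + 1) = 2 * J + 2 by ring, poch_succ, Nat.factorial_succ]
    push_cast at h ⊢
    field_simp at h ⊢
    linear_combination h

theorem altSum_zero_odd (A : ℝ) (J : ℕ) : altSum 0 A (2 * J + 1) = 0 := by
  induction J with
  | zero => simp [altSum, Finset.Nat.antidiagonal_succ, mul_comm]
  | succ J ih =>
    have h := altSum_zero_rec A (2 * J + 1)
    rw [ih, mul_zero] at h
    have h2 : ((2 * J + 1 : ℕ) : ℝ) + 2 ≠ 0 := by positivity
    exact (mul_eq_zero.mp h).resolve_left h2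

theorem negBinom_succ_sub (A : ℝ) (n : ℕ) :
    negBinom (A + 1) (n + 1) - negBinom (A + 1) n = negBinom A (n + 1) := by
  have h1 := succ_mul_negBinom_succ A n
  have h2 := succ_mul_negBinom_succ' (A + 1) n
  have h : (n : ℝ) + 1 ≠ 0 := by positivity
  apply mul_left_cancel₀ h
  linear_combination h2 - h1

/-- The alternating convolution of `(1 + t) ^ (-A - 1)` and `(1 - t) ^ (-A - 2)`. -/
theorem sum_negBinom_mul_negBinom_add_one (A : ℝ) (J : ℕ) :
    ∑ x ∈ Finset.HasAntidiagonal.antidiagonal (2 * J), (-1) ^ x.1 * (negBinom A x.1 * negBinom (A + 1) x.2) =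
      poch (A + 2) J / (J ! : ℝ) := by
  cases J with
  | zero => simp [negBinom_zero, poch_zero]
  | succ J =>
    have h1 : altSum 0 (A + 1) (2 * J + 1) = 0 := altSum_zero_odd _ _
    have h2 := altSum_zero_even (A + 1) (J + 1)
    rw [show 2 * (J + 1) = 2 * J + 1 + 1 by ring] at h2 ⊢
    rw [altSum, Finset.Nat.antidiagonal_succ, Finset.sum_cons, Finset.sum_map] at h2
    rw [altSum] at h1
    rw [Finset.Nat.antidiagonal_succ, Finset.sum_cons, Finset.sum_map]
    rw [show A + 2 = A + 1 + 1 by ring, ← h2]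
    simp only [pow_zero, mul_one, one_mul, negBinom_zero, Function.Embedding.prodMap,
      Function.Embedding.coeFn_mk, Prod.map, Nat.succ_eq_add_one, Function.Embedding.refl_apply] at h1 h2 ⊢
    congr 1
    -- In generating functions, `(1 + t) ^ (-A - 1) (1 - t) ^ (-A - 2) = (1 + t) (1 - t ^ 2) ^ (-A -
    -- 2)`. The term `t` only reaches odd degrees, so here it contributes the vanishing sum `h1`.
    rw [← sub_eq_zero, ← Finset.sum_sub_distrib, ← h1]
    refine Finset.sum_congr rfl fun x _ => ?_
    rw [← negBinom_succ_sub]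
    ring

/-- With `x + y = M`, the factor `y - x` is `2 y - M`. The constant part vanishes for odd `M`, and
`y` is absorbed by raising the parameter of the second coefficient. -/
theorem altSum_one (A : ℝ) (J : ℕ) :
    altSum 1 A (2 * J + 1) = 2 * poch (A + 1) (J + 1) / (J ! : ℝ) := by
  have h0 := altSum_zero_odd A J
  have h1 : ∑ x ∈ Finset.HasAntidiagonal.antidiagonal (2 * J + 1),
      (-1) ^ x.1 * (x.2 : ℝ) * (negBinom A x.1 * negBinom A x.2) =
      (A + 1) * (poch (A + 2) J / (J ! : ℝ)) := by
    rw [← sum_negBinom_mul_negBinom_add_one, Finset.mul_sum, Finset.Nat.antidiagonal_succ',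
      Finset.sum_cons, Finset.sum_map]
    simp only [Function.Embedding.prodMap, Function.Embedding.coeFn_mk, Prod.map,
      Nat.succ_eq_add_one, Function.Embedding.refl_apply, Nat.cast_zero, mul_zero, zero_mul,
      zero_add]
    refine Finset.sum_congr rfl fun x _ => ?_
    have := succ_mul_negBinom_succ A x.2
    push_cast
    linear_combination (-1) ^ x.1 * negBinom A x.1 * this
  have h2 : altSum 1 A (2 * J + 1) = 2 * ∑ x ∈ Finset.HasAntidiagonal.antidiagonal (2 * J + 1),
      (-1) ^ x.1 * (x.2 : ℝ) * (negBinom A x.1 * negBinom A x.2) -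
      (2 * J + 1) * altSum 0 A (2 * J + 1) := by
    rw [altSum, altSum, Finset.mul_sum, Finset.mul_sum, ← Finset.sum_sub_distrib]
    refine Finset.sum_congr rfl fun x hx => ?_
    have : (x.1 : ℝ) + x.2 = 2 * J + 1 := by 
      exact_mod_cast Finset.HasAntidiagonal.mem_antidiagonal.mp hx
    rw [← this]
    ring
  rw [h2, h1, h0, poch_succ_left, show A + 1 + 1 = A + 2 by ring]
  ring

/-- Here `(y - x) ^ 2 = M ^ 2 - 4 x y`, and `x y` is absorbed by raising both parameters, which
leads back to exponent zero with `A + 1` and `M - 2`. -/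
theorem altSum_two (A : ℝ) (J : ℕ) :
    altSum 2 A (2 * (J + 1)) = 4 * poch (A + 1) (J + 2) / (J ! : ℝ) := by
  have h0 := altSum_zero_even A (J + 1)
  have h1 : ∑ x ∈ Finset.HasAntidiagonal.antidiagonal (2 * (J + 1)),
      (-1) ^ x.1 * ((x.1 : ℝ) * x.2) * (negBinom A x.1 * negBinom A x.2) =
      -(A + 1) ^ 2 * (poch (A + 2) J / (J ! : ℝ)) := by
    rw [show 2 * (J + 1) = 2 * J + 1 + 1 by ring, show A + 2 = A + 1 + 1 by ring,
      ← altSum_zero_even, altSum, Finset.mul_sum, Finset.Nat.antidiagonal_succ',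
      Finset.sum_cons, Finset.sum_map, Finset.Nat.antidiagonal_succ, Finset.sum_cons,
      Finset.sum_map]
    simp only [Function.Embedding.prodMap, Function.Embedding.coeFn_mk, Prod.map,
      Nat.succ_eq_add_one, Function.Embedding.refl_apply, Nat.cast_zero, mul_zero, zero_mul,
      zero_add]
    refine Finset.sum_congr rfl fun x _ => ?_
    have h1 := succ_mul_negBinom_succ A x.1
    have h2 := succ_mul_negBinom_succ A x.2
    push_cast
    linear_combination -(-1) ^ x.1 * ((x.2 + 1) * negBinom A (x.2 + 1)) * h1 -
      (-1) ^ x.1 * ((A + 1) * negBinom (A + 1) x.1) * h2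
  have h2 : altSum 2 A (2 * (J + 1)) = (2 * (J + 1)) ^ 2 * altSum 0 A (2 * (J + 1)) -
      4 * ∑ x ∈ Finset.HasAntidiagonal.antidiagonal (2 * (J + 1)),
      (-1) ^ x.1 * ((x.1 : ℝ) * x.2) * (negBinom A x.1 * negBinom A x.2) := by
    rw [altSum, altSum, Finset.mul_sum, Finset.mul_sum, ← Finset.sum_sub_distrib]
    refine Finset.sum_congr rfl fun x hx => ?_
    have : (x.1 : ℝ) + x.2 = 2 * (J + 1) := by 
      exact_mod_cast Finset.HasAntidiagonal.mem_antidiagonal.mp hx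
    rw [← this]
    ring
  have h3 := Nat.factorial_ne_zero J
  have h4 : (J : ℝ) + 1 ≠ 0 := by positivity
  rw [h2, h1, h0, show J + 2 = (J + 1) + 1 by ring, poch_succ (A + 1) (J + 1), poch_succ_left (A + 1) J,
    Nat.factorial_succ, show A + 1 + 1 = A + 2 by ring]
  push_cast
  field_simp
  ring

/-! ### Alternating moments of the Hahn weight. -/

/-- One half of the absorption into the weight: `(-n)_m` lowers the index `n = m + x` to `x`, and
the parameter rises to `α + m + p`. -/
theorem poch_neg_mul_negBinom (α : ℝ) (m x p : ℕ) :
    poch (-((m + x : ℕ) : ℝ)) m * poch (α + 1 + ((m + x : ℕ) : ℝ)) p * negBinom α (m + x) =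
      (-1) ^ m * poch (α + 1) (m + p) * negBinom (α + m + p) x := by
  have h1 := poch_neg_natCast_mul_factorial (Nat.le_add_right m x)
  rw [Nat.add_sub_cancel_left] at h1
  have h2 := Nat.factorial_ne_zero x
  have h3 := Nat.factorial_ne_zero (m + x)
  have h4 : poch (α + 1) (m + x) * poch (α + 1 + ((m + x : ℕ) : ℝ)) p =
      poch (α + 1) (m + p) * poch (α + m + p + 1) x := by
    rw [← poch_add, show m + x + p = (m + p) + x by ring, poch_add]
    congr 2
    push_cast
    ring
  rw [negBinom, negBinom]
  field_simp
  linear_combination poch (α + 1 + ((m + x : ℕ) : ℝ)) p * poch (α + 1) (m + x) * h1 +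
    (-1) ^ m * ((m + x)! : ℝ) * h4

/-- Alternating moments of the Hahn weight in the products of the bases
`(-n)_m (n - N)_m` and `(α + 1 + n)_p (α + 1 + N - n)_p`. -/
theorem sum_hahnW_poch (s : ℕ) (α : ℝ) (m p M : ℕ) :
    ∑ n ∈ Finset.range (2 * m + M + 1), (-1) ^ n * hahnW n α α (2 * m + M) *
        (poch (-(n : ℝ)) m * poch ((n : ℝ) - (2 * m + M : ℕ)) m) *
        (poch (α + 1 + n) p * poch (α + 1 + (2 * m + M : ℕ) - n) p) *
        ((2 * m + M : ℕ) - 2 * (n : ℝ)) ^ s =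
      (-1) ^ m * poch (α + 1) (m + p) ^ 2 * altSum s (α + m + p) M := by
  rw [show 2 * m + M + 1 = m + (M + 1 + m) by ring, Finset.sum_range_add,
    Finset.sum_range_add _ (M + 1) m]
  -- The terms with `n < m` vanish by `(-n)_m`, those with `n > m + M` by `(n - N)_m`; the middle
  -- block is indexed by `n = m + x`.
  rw [Finset.sum_eq_zero, zero_add, add_eq_left.mpr]
  · rw [altSum, Finset.Nat.sum_antidiagonal_eq_sum_range_succ_mk, Finset.mul_sum]
    refine Finset.sum_congr rfl fun x hx => ?_
    have hx' : x ≤ M := Nat.lt_succ_iff.mp (Finset.mem_range.mp hx)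
    obtain ⟨y, rfl⟩ := Nat.exists_eq_add_of_le hx'
    have h1 := poch_neg_mul_negBinom α m x p
    have h2 := poch_neg_mul_negBinom α m y p
    have e1 : (((m + x : ℕ) : ℝ) - (2 * m + (x + y) : ℕ)) = -((m + y : ℕ) : ℝ) := by
      push_cast; ring
    have e2 : α + 1 + (2 * m + (x + y) : ℕ) - ((m + x : ℕ) : ℝ) = α + 1 + ((m + y : ℕ) : ℝ) := by
      push_cast; ring
    have e3 : ((2 * m + (x + y) : ℕ) : ℝ) - 2 * ((m + x : ℕ) : ℝ) = y - x := by
      push_cast; ring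
    rw [hahnW_eq _ _ (by omega), e1, e2, e3, show 2 * m + (x + y) - (m + x) = m + y by omega,
      Nat.add_sub_cancel_left]
    simp only
    have h4 : (-1 : ℝ) ^ m * (-1) ^ m = 1 := by rw [← mul_pow]; simp
    have h3 := congrArg₂ (· * ·) h1 h2
    rw [pow_add]
    linear_combination (-1) ^ m * (-1) ^ x * ((y : ℝ) - x) ^ s * h3 +
      (-1) ^ m * (-1) ^ x * ((y : ℝ) - x) ^ s * poch (α + 1) (m + p) ^ 2 *
        negBinom (α + m + p) x * negBinom (α + m + p) y * h4
  · refine Finset.sum_eq_zero fun i hi => ?_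
    have hi' := Finset.mem_range.mp hi
    have e : ((m + (M + 1 + i) : ℕ) : ℝ) - (2 * m + M : ℕ) = -((m - 1 - i : ℕ) : ℝ) := by
      rw [show m - 1 - i = m - (1 + i) by omega, Nat.cast_sub (by omega)]
      push_cast
      ring
    rw [e, poch_neg_natCast_eq_zero (n := m - 1 - i) (by omega)]
    ring
  · intro i hi
    rw [poch_neg_natCast_eq_zero (Finset.mem_range.mp hi)]
    ring

/-! ### Expansions of symmetric Hahn polynomials in two bases. -/

theorem hypSeries_eq_sum {as : List ℝ} (bs : List ℝ) {K : ℕ} (h : -(K : ℝ) ∈ as) :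
    hypSeries as bs 1 = ∑ n ∈ Finset.range (K + 1),
      (as.map fun a => poch a n).prod / ((bs.map fun b => poch b n).prod * (n ! : ℝ)) := by
  rw [hypSeries, tsum_eq_sum (s := Finset.range (K + 1))]
  · simp
  · intro n hn
    have h0 : (as.map fun a => poch a n).prod = 0 :=
      List.prod_eq_zero (List.mem_map.mpr ⟨_, h, poch_neg_natCast_eq_zero (by simpa using hn)⟩)
    rw [h0]
    simp

theorem hahnQ_eq_sum (k : ℕ) (x α : ℝ) (N : ℕ) :
    hahnQ k x α α N = ∑ r ∈ Finset.range (k + 1),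
      poch (-(k : ℝ)) r * poch (k + 2 * α + 1) r * poch (-x) r /
        (poch (α + 1) r * poch (-(N : ℝ)) r * (r ! : ℝ)) := by
  rw [hahnQ, hypSeries_eq_sum (K := k) _ (by simp)]
  refine Finset.sum_congr rfl fun r _ => ?_
  simp only [List.map_cons, List.map_nil, List.prod_cons, List.prod_nil]
  rw [show (k : ℝ) + α + α + 1 = k + 2 * α + 1 by ring]
  ring

theorem poch_add_one_ne_zero {α : ℝ} (hα : -1 < α) (n : ℕ) : poch (α + 1) n ≠ 0 :=
  (poch_pos (by linarith) n).ne'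

/-- Hahn polynomials of even degree in the basis `(-x)_m (x - N)_m`. -/
theorem hahnQ_even {α : ℝ} (hα : -1 < α) {K N : ℕ} (hK : 2 * K ≤ N) (x : ℝ) :
    hahnQ (2 * K) x α α N = ∑ m ∈ Finset.range (K + 1),
      poch (-(K : ℝ)) m * poch (K + α + 1 / 2) m / (poch (α + 1) m * (m ! : ℝ)) *
        (4 ^ m / poch (-(N : ℝ)) (2 * m)) * (poch (-x) m * poch (x - N) m) := by
  rw [hahnQ_eq_sum, sum_quadratic_even K (poch_add_one_ne_zero hα) _
    (poch_neg_natCast_ne_zero hK)]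
  refine Finset.sum_congr rfl fun r _ => ?_
  rw [show -(N : ℝ) - -x = x - N by ring]
  ring

/-- Hahn polynomials of odd degree in the basis `(N - 2 x) (-x)_m (x - N)_m`. -/
theorem hahnQ_odd {α : ℝ} (hα : -1 < α) {K N : ℕ} (hK : 2 * K + 1 ≤ N) (x : ℝ) :
    hahnQ (2 * K + 1) x α α N = -(N - 2 * x) * ∑ m ∈ Finset.range (K + 1),
      poch (-(K : ℝ)) m * poch (K + α + 3 / 2) m / (poch (α + 1) m * (m ! : ℝ)) *
        (4 ^ m / poch (-(N : ℝ)) (2 * m + 1)) * (poch (-x) m * poch (x - N) m) := by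
  rw [hahnQ_eq_sum, sum_quadratic_odd K (poch_add_one_ne_zero hα) _
    (poch_neg_natCast_ne_zero hK), show -(N : ℝ) - 2 * -x = -(N - 2 * x) by ring]
  congr 1
  refine Finset.sum_congr rfl fun r _ => ?_
  rw [show -(N : ℝ) - -x = x - N by ring]
  ring

/-- This replaces `(-x)_r / (-N)_r` by `(α + 1 + x)_r / (N + 2α + 2)_r`, again of the form required
by the quadratic transformations, and so gives access to the second basis. -/
theorem hahnQ_sheppard {α : ℝ} (hα : -1 < α) {k N : ℕ} (hk : k ≤ N) (x : ℝ) :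
    hahnQ k x α α N = (-1) ^ k * poch (N + 2 * α + 2) k / poch (-(N : ℝ)) k *
      ∑ r ∈ Finset.range (k + 1),
        poch (-(k : ℝ)) r * poch (k + 2 * α + 1) r * poch (α + 1 + x) r /
          (poch (α + 1) r * poch (N + 2 * α + 2) r * (r ! : ℝ)) := by
  have hN : (0 : ℝ) ≤ N := Nat.cast_nonneg N
  have hf : poch (N + 2 * α + 2) k ≠ 0 := (poch_pos (by linarith) k).ne'
  have he : poch (-(N : ℝ)) k ≠ 0 := poch_neg_natCast_ne_zero hk
  have h := sum_sheppard k (-x) (a := k + 2 * α + 1) (d := α + 1) (e := -(N : ℝ))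
    (f := N + 2 * α + 2) (by ring) (poch_add_one_ne_zero hα) hf he
  rw [sub_neg_eq_add, ← hahnQ_eq_sum] at h
  rw [h]
  have h2 : (-1 : ℝ) ^ k * (-1) ^ k = 1 := by rw [← mul_pow]; simp
  field_simp
  linear_combination -hahnQ k x α α N * h2

/-- Hahn polynomials of even degree in the basis `(α + 1 + x)_p (α + 1 + N - x)_p`. -/
theorem hahnQ_even_dual {α : ℝ} (hα : -1 < α) {L N : ℕ} (hL : 2 * L ≤ N) (x : ℝ) :
    hahnQ (2 * L) x α α N = poch (N + 2 * α + 2) (2 * L) / poch (-(N : ℝ)) (2 * L) *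
      ∑ p ∈ Finset.range (L + 1),
        poch (-(L : ℝ)) p * poch (L + α + 1 / 2) p / (poch (α + 1) p * (p ! : ℝ)) *
          (4 ^ p / poch (N + 2 * α + 2) (2 * p)) *
          (poch (α + 1 + x) p * poch (α + 1 + N - x) p) := by
  have hN : (0 : ℝ) ≤ N := Nat.cast_nonneg N
  rw [hahnQ_sheppard hα hL, sum_quadratic_even L (poch_add_one_ne_zero hα) _
    (poch_pos (by linarith) _).ne', pow_mul]
  simp only [even_two, Even.neg_pow, one_pow, one_mul]
  congr 1
  refine Finset.sum_congr rfl fun r _ => ?_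
  rw [show N + 2 * α + 2 - (α + 1 + x) = α + 1 + N - x by ring]
  ring

/-- Hahn polynomials of odd degree in the basis
`(N - 2 x) (α + 1 + x)_p (α + 1 + N - x)_p`. -/
theorem hahnQ_odd_dual {α : ℝ} (hα : -1 < α) {L N : ℕ} (hL : 2 * L + 1 ≤ N) (x : ℝ) :
    hahnQ (2 * L + 1) x α α N =
      -poch (N + 2 * α + 2) (2 * L + 1) / poch (-(N : ℝ)) (2 * L + 1) * ((N - 2 * x) *
      ∑ p ∈ Finset.range (L + 1),
        poch (-(L : ℝ)) p * poch (L + α + 3 / 2) p / (poch (α + 1) p * (p ! : ℝ)) *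
          (4 ^ p / poch (N + 2 * α + 2) (2 * p + 1)) *
          (poch (α + 1 + x) p * poch (α + 1 + N - x) p)) := by
  have hN : (0 : ℝ) ≤ N := Nat.cast_nonneg N
  rw [hahnQ_sheppard hα hL, sum_quadratic_odd L (poch_add_one_ne_zero hα) _
    (poch_pos (by linarith) _).ne', pow_succ, pow_mul]
  simp only [even_two, Even.neg_pow, one_pow, one_mul, neg_mul]
  rw [show N + 2 * α + 2 - 2 * (α + 1 + x) = N - 2 * x by ring]
  congr 2
  refine Finset.sum_congr rfl fun r _ => ?_
  rw [show N + 2 * α + 2 - (α + 1 + x) = α + 1 + N - x by ring]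
  ring

/-- The products `(-x)_m (x - N)_m` are invariant under `x ↦ N - x`, and the factor `N - 2 x` of odd
degrees changes sign. -/
theorem hahnQ_reflect {α : ℝ} (hα : -1 < α) {k N : ℕ} (hk : k ≤ N) (x : ℝ) :
    hahnQ k (N - x) α α N = (-1) ^ k * hahnQ k x α α N := by
  rcases Nat.even_or_odd' k with ⟨K, rfl | rfl⟩
  · rw [hahnQ_even hα hk, hahnQ_even hα hk, pow_mul]
    simp only [even_two, Even.neg_pow, one_pow, one_mul]
    refine Finset.sum_congr rfl fun r _ => ?_
    rw [show -((N : ℝ) - x) = x - N by ring, show (N : ℝ) - x - N = -x by ring]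
    ring
  · rw [hahnQ_odd hα hk, hahnQ_odd hα hk, pow_succ, pow_mul]
    simp only [even_two, Even.neg_pow, one_pow, one_mul, Finset.mul_sum]
    refine Finset.sum_congr rfl fun r _ => ?_
    rw [show -((N : ℝ) - x) = x - N by ring, show (N : ℝ) - x - N = -x by ring]
    ring

/-! ### Moments of products of the two expansions. -/

/-- Expansion of an alternating sum against the Hahn weight into moments. -/
theorem sum_hahnW_mul_expansions (s : ℕ) (α : ℝ) {K L N : ℕ} (hK : 2 * K ≤ N) (u v : ℕ → ℝ) :
    ∑ n ∈ Finset.range (N + 1), (-1) ^ n * hahnW n α α N * ((N : ℝ) - 2 * n) ^ s *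
        (∑ m ∈ Finset.range (K + 1), u m * (poch (-(n : ℝ)) m * poch ((n : ℝ) - N) m)) *
        (∑ p ∈ Finset.range (L + 1), v p * (poch (α + 1 + n) p * poch (α + 1 + N - n) p)) =
      ∑ m ∈ Finset.range (K + 1), ∑ p ∈ Finset.range (L + 1),
        u m * v p * ((-1) ^ m * poch (α + 1) (m + p) ^ 2 * altSum s (α + m + p) (N - 2 * m)) := by
  have h1 : ∀ m ∈ Finset.range (K + 1), ∀ p ∈ Finset.range (L + 1),
      u m * v p * ((-1) ^ m * poch (α + 1) (m + p) ^ 2 * altSum s (α + m + p) (N - 2 * m)) =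
      ∑ n ∈ Finset.range (N + 1), (-1) ^ n * hahnW n α α N * ((N : ℝ) - 2 * n) ^ s *
        ((u m * (poch (-(n : ℝ)) m * poch ((n : ℝ) - N) m)) *
        (v p * (poch (α + 1 + n) p * poch (α + 1 + N - n) p))) := by
    intro m hm p _
    have hm' : m ≤ K := Nat.lt_succ_iff.mp (Finset.mem_range.mp hm)
    have := sum_hahnW_poch s α m p (N - 2 * m)
    rw [Nat.add_sub_cancel' (by omega : 2 * m ≤ N)] at this
    rw [← this, Finset.mul_sum]
    refine Finset.sum_congr rfl fun n _ => ?_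
    ring
  rw [Finset.sum_congr rfl fun m hm => Finset.sum_congr rfl (h1 m hm)]
  simp_rw [Finset.sum_comm (s := Finset.range (L + 1))]
  rw [Finset.sum_comm]
  refine Finset.sum_congr rfl fun n _ => ?_
  rw [mul_assoc, Finset.sum_mul_sum, Finset.mul_sum]
  simp_rw [Finset.mul_sum]

/-- On the right, `m` and `p` interact only through `(α + 1)_{m + p}`, the shape needed for
`sum_sum_poch_add`. The next two lemmas do the same for exponents one and two. -/
theorem altSum_zero_moment (α : ℝ) {J m : ℕ} (hm : m ≤ J) (p : ℕ) :
    (-1) ^ m * poch (α + 1) (m + p) ^ 2 * altSum 0 (α + m + p) (2 * J - 2 * m) =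
      poch (α + 1) J / (J ! : ℝ) *
        (poch (α + 1) (m + p) * poch (α + J + 1) p * poch (-(J : ℝ)) m) := by
  obtain ⟨t, rfl⟩ := Nat.exists_eq_add_of_le hm
  have h1 := poch_neg_natCast_mul_factorial hm
  rw [Nat.add_sub_cancel_left] at h1
  rw [show 2 * (m + t) - 2 * m = 2 * t by omega, altSum_zero_even]
  have h2 : poch (α + 1) (m + p) * poch (α + m + p + 1) t =
      poch (α + 1) (m + t) * poch (α + (m + t : ℕ) + 1) p := by
    rw [show α + m + p + 1 = α + 1 + (m + p : ℕ) by push_cast; ring,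
      show α + (m + t : ℕ) + 1 = α + 1 + (m + t : ℕ) by ring, ← poch_add, ← poch_add,
      add_right_comm]
  have := Nat.factorial_ne_zero t
  have := Nat.factorial_ne_zero (m + t)
  field_simp
  linear_combination poch (α + 1) (m + p) * ((-1) ^ m * ((m + t)! : ℝ) * h2 -
    poch (α + 1) (m + t) * poch (α + (m + t : ℕ) + 1) p * h1)

theorem altSum_one_moment (α : ℝ) {J m : ℕ} (hm : m ≤ J) (p : ℕ) :
    (-1) ^ m * poch (α + 1) (m + p) ^ 2 * altSum 1 (α + m + p) (2 * J + 1 - 2 * m) =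
      2 * poch (α + 1) (J + 1) / (J ! : ℝ) *
        (poch (α + 1) (m + p) * poch (α + J + 2) p * poch (-(J : ℝ)) m) := by
  obtain ⟨t, rfl⟩ := Nat.exists_eq_add_of_le hm
  have h1 := poch_neg_natCast_mul_factorial hm
  rw [Nat.add_sub_cancel_left] at h1
  rw [show 2 * (m + t) + 1 - 2 * m = 2 * t + 1 by omega, altSum_one]
  have h2 : poch (α + 1) (m + p) * poch (α + m + p + 1) (t + 1) =
      poch (α + 1) (m + t + 1) * poch (α + (m + t : ℕ) + 2) p := by
    rw [show α + m + p + 1 = α + 1 + (m + p : ℕ) by push_cast; ring,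
      show α + (m + t : ℕ) + 2 = α + 1 + (m + t + 1 : ℕ) by push_cast; ring, ← poch_add,
      ← poch_add]
    congr 1
    ring
  have := Nat.factorial_ne_zero t
  have := Nat.factorial_ne_zero (m + t)
  field_simp
  linear_combination poch (α + 1) (m + p) * ((-1) ^ m * ((m + t)! : ℝ) * h2 -
    poch (α + 1) (m + t + 1) * poch (α + (m + t : ℕ) + 2) p * h1)

theorem altSum_two_moment (α : ℝ) {J m : ℕ} (hm : m ≤ J) (p : ℕ) :
    (-1) ^ m * poch (α + 1) (m + p) ^ 2 * altSum 2 (α + m + p) (2 * (J + 1) - 2 * m) =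
      4 * poch (α + 1) (J + 2) / (J ! : ℝ) *
        (poch (α + 1) (m + p) * poch (α + J + 3) p * poch (-(J : ℝ)) m) := by
  obtain ⟨t, rfl⟩ := Nat.exists_eq_add_of_le hm
  have h1 := poch_neg_natCast_mul_factorial hm
  rw [Nat.add_sub_cancel_left] at h1
  rw [show 2 * (m + t + 1) - 2 * m = 2 * (t + 1) by omega, altSum_two]
  have h2 : poch (α + 1) (m + p) * poch (α + m + p + 1) (t + 2) =
      poch (α + 1) (m + t + 2) * poch (α + (m + t : ℕ) + 3) p := by
    rw [show α + m + p + 1 = α + 1 + (m + p : ℕ) by push_cast; ring,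
      show α + (m + t : ℕ) + 3 = α + 1 + (m + t + 2 : ℕ) by push_cast; ring, ← poch_add,
      ← poch_add]
    congr 1
    ring
  have := Nat.factorial_ne_zero t
  have := Nat.factorial_ne_zero (m + t)
  field_simp
  linear_combination poch (α + 1) (m + p) * ((-1) ^ m * ((m + t)! : ℝ) * h2 -
    poch (α + 1) (m + t + 2) * poch (α + (m + t : ℕ) + 3) p * h1)

/-! ### The three closed forms of `S`. -/

theorem poch_half_mul {J K : ℕ} (h : K ≤ J) :
    poch (1 / 2) (J - K) * poch (1 / 2 - J) K = (-1) ^ K * poch (1 / 2) J := by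
  obtain ⟨t, rfl⟩ := Nat.exists_eq_add_of_le' h
  have := poch_reflect (1 / 2 + t) K
  rw [show (1 : ℝ) - (1 / 2 + t) - K = 1 / 2 - (t + K : ℕ) by push_cast; ring] at this
  rw [Nat.add_sub_cancel, this, poch_add (1 / 2)]
  ring

theorem poch_one_eq_factorial (n : ℕ) : poch 1 n = (n ! : ℝ) := by
  simp [poch, ascPochhammer_eval_one]

theorem factorial_two_mul (J : ℕ) : ((2 * J)! : ℝ) = 4 ^ J * (J ! : ℝ) * poch (1 / 2) J := by
  rw [← poch_one_eq_factorial, poch_two_mul, show ((1 : ℝ) + 1) / 2 = 1 by norm_num,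
    poch_one_eq_factorial]
  ring

theorem poch_half_sub_ne_zero {J K : ℕ} (h : K ≤ J) : poch (1 / 2 - (J : ℝ)) K ≠ 0 := by
  have h1 := poch_half_mul h
  have h2 : poch (1 / 2) J ≠ 0 := (poch_pos (by norm_num) J).ne'
  intro h3
  rw [h3, mul_zero] at h1
  exact mul_ne_zero (pow_ne_zero K (by norm_num)) h2 h1.symm

theorem hypSeries_four_three (K L : ℕ) (a a' d e e' : ℝ) :
    hypSeries [-(K : ℝ), a, -(L : ℝ), a'] [e, d, e'] 1 = ∑ i ∈ Finset.range (K + 1),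
      poch (-(K : ℝ)) i * poch a i * poch (-(L : ℝ)) i * poch a' i /
        (poch d i * poch e i * poch e' i * (i ! : ℝ)) := by
  rw [hypSeries_eq_sum (K := K) _ (by simp)]
  refine Finset.sum_congr rfl fun r _ => ?_
  simp only [List.map_cons, List.map_nil, List.prod_cons, List.prod_nil]
  ring

theorem kernelS_even_even {α : ℝ} (hα : -1 < α) {J K L : ℕ} (hK : K ≤ J) (hL : L ≤ J) :
    kernelS (2 * K) (2 * L) α (2 * J) =
      2 ^ (2 * J) * poch (1 / 2) (J - K) * poch (1 / 2) (J - L) * poch (α + 1) J *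
          poch (α + J + 1) K * poch (α + J + 1) L / (((2 * J)! : ℝ) * poch (1 / 2) J) *
        hypSeries [-(K : ℝ), K + α + 1 / 2, -(L : ℝ), L + α + 1 / 2]
          [α + J + 1, α + 1, -(J : ℝ)] 1 := by
  have hJ0 : (0 : ℝ) ≤ J := Nat.cast_nonneg J
  have hE : ∀ n, poch (α + J + 1) n ≠ 0 := fun n => (poch_pos (by linarith) n).ne'
  have hF : ∀ n, poch (α + J + 3 / 2) n ≠ 0 := fun n => (poch_pos (by linarith) n).ne'
  have hd := poch_add_one_ne_zero hα
  -- The parameters `f`, `f'` are the half-integer-shifted factors of `(-N)_{2m}` and `(N + 2α +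
  -- 2)_{2p}` under duplication. Their balancing partners `e`, `e'` become lower parameters of the
  -- `₄F₃`.
  have hD := sum_sum_poch_add K L (a := K + α + 1 / 2) (a' := L + α + 1 / 2) (d := α + 1)
    (e := α + J + 1) (e' := -(J : ℝ)) (f := 1 / 2 - J) (f' := α + J + 3 / 2)
    (by ring) (by ring) hd (poch_half_sub_ne_zero hK) (hE K) (hF L)
    (poch_neg_natCast_ne_zero hL)
  have hN : ∀ m, poch (-((2 * J : ℕ) : ℝ)) (2 * m) =
      4 ^ m * poch (-(J : ℝ)) m * poch (1 / 2 - J) m := by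
    intro m
    rw [poch_two_mul, show -((2 * J : ℕ) : ℝ) / 2 = -J by push_cast; ring,
      show (-((2 * J : ℕ) : ℝ) + 1) / 2 = 1 / 2 - J by push_cast; ring]
  have hA : ∀ p, poch ((2 * J : ℕ) + 2 * α + 2) (2 * p) =
      4 ^ p * poch (α + J + 1) p * poch (α + J + 3 / 2) p := by
    intro p
    rw [poch_two_mul, show ((2 * J : ℕ) + 2 * α + 2 : ℝ) / 2 = α + J + 1 by push_cast; ring,
      show ((2 * J : ℕ) + 2 * α + 2 + 1 : ℝ) / 2 = α + J + 3 / 2 by push_cast; ring]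
  have hS := sum_hahnW_mul_expansions 0 α (K := K) (L := L) (N := 2 * J) (by omega)
    (fun m => poch (-(K : ℝ)) m * poch (K + α + 1 / 2) m / (poch (α + 1) m * (m ! : ℝ)) *
        (4 ^ m / poch (-((2 * J : ℕ) : ℝ)) (2 * m)))
    (fun p => poch (-(L : ℝ)) p * poch (L + α + 1 / 2) p / (poch (α + 1) p * (p ! : ℝ)) *
        (4 ^ p / poch ((2 * J : ℕ) + 2 * α + 2) (2 * p)))
  -- The factors `(-J)_m` and `(α + J + 1)_p` of the moment cancel the other halves of the
  -- duplicated denominators.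
  have hT : ∑ m ∈ Finset.range (K + 1), ∑ p ∈ Finset.range (L + 1),
      (poch (-(K : ℝ)) m * poch (K + α + 1 / 2) m / (poch (α + 1) m * (m ! : ℝ)) *
        (4 ^ m / poch (-((2 * J : ℕ) : ℝ)) (2 * m))) *
      (poch (-(L : ℝ)) p * poch (L + α + 1 / 2) p / (poch (α + 1) p * (p ! : ℝ)) *
        (4 ^ p / poch ((2 * J : ℕ) + 2 * α + 2) (2 * p))) *
      ((-1) ^ m * poch (α + 1) (m + p) ^ 2 * altSum 0 (α + m + p) (2 * J - 2 * m)) =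
      poch (α + 1) J / (J ! : ℝ) * (∑ m ∈ Finset.range (K + 1), ∑ p ∈ Finset.range (L + 1),
        (poch (-(K : ℝ)) m * poch (K + α + 1 / 2) m / (poch (1 / 2 - J) m * (m ! : ℝ))) *
        (poch (-(L : ℝ)) p * poch (L + α + 1 / 2) p / (poch (α + J + 3 / 2) p * (p ! : ℝ))) *
        (poch (α + 1) (m + p) / (poch (α + 1) m * poch (α + 1) p))) := by
    simp_rw [Finset.mul_sum]
    refine Finset.sum_congr rfl fun m hm => Finset.sum_congr rfl fun p _ => ?_
    have hm' : m ≤ J := (Nat.lt_succ_iff.mp (Finset.mem_range.mp hm)).trans hK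
    rw [altSum_zero_moment α hm', hN, hA]
    have := hE p
    have := hF p
    have := hd m
    have := hd p
    have := poch_half_sub_ne_zero hm'
    have := poch_neg_natCast_ne_zero hm'
    have := Nat.factorial_ne_zero m
    have := Nat.factorial_ne_zero p
    field_simp
  have hT' := congrArg (fun T => poch ((2 * J : ℕ) + 2 * α + 2) (2 * L) /
      poch (-((2 * J : ℕ) : ℝ)) (2 * L) * T)
    (hS.trans (hT.trans (congrArg
      (fun T => poch (α + 1) J / (J ! : ℝ) * T) hD)))
  beta_reduce at hT'
  have h1 : kernelS (2 * K) (2 * L) α (2 * J) = _ := Eq.trans (by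
    rw [kernelS, Finset.mul_sum]
    refine Finset.sum_congr rfl fun n _ => ?_
    rw [hahnQ_even hα (by omega), hahnQ_even_dual hα (by omega)]
    ring) hT'
  have h2 := poch_half_mul hK
  have h3 := poch_half_mul hL
  have := hE L
  have := hF L
  have := poch_half_sub_ne_zero hK
  have := poch_half_sub_ne_zero hL
  have := poch_neg_natCast_ne_zero hL
  have := Nat.factorial_ne_zero J
  have h4 : poch (1 / 2) J ≠ 0 := (poch_pos (by norm_num) J).ne'
  have e1 := eq_div_of_mul_eq (poch_half_sub_ne_zero hK) h2
  have e2 := eq_div_of_mul_eq (poch_half_sub_ne_zero hL) h3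
  rw [h1, hypSeries_four_three, hN, hA, factorial_two_mul, pow_mul, e1, e2,
    show (2 : ℝ) ^ 2 = 4 by norm_num]
  generalize poch (1 / 2 - (J : ℝ)) K = z at *
  generalize poch (1 / 2 - (J : ℝ)) L = z' at *
  generalize poch (α + J + 3 / 2) L = y at *
  generalize Finset.sum (M := ℝ) (Finset.range (K + 1)) _ = T
  field_simp

/-- Two odd degrees contribute `(N - 2 n) ^ 2`, hence exponent two. The half-length is written `J +
1`, which is automatically positive and turns the last lower parameter into `-J`. -/
theorem kernelS_odd_odd {α : ℝ} (hα : -1 < α) {J K L : ℕ} (hK : K ≤ J) (hL : L ≤ J) :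
    kernelS (2 * K + 1) (2 * L + 1) α (2 * (J + 1)) =
      2 ^ (2 * (J + 1)) * poch (1 / 2) (J + 1 - K) * poch (1 / 2) (J + 1 - L) *
          poch (α + 1) (J + 2) * poch (α + J + 3) K * poch (α + J + 3) L /
          (((2 * (J + 1))! : ℝ) * (J + 1) * poch (1 / 2) (J + 1)) *
        hypSeries [-(K : ℝ), K + α + 3 / 2, -(L : ℝ), L + α + 3 / 2]
          [α + J + 3, α + 1, -(J : ℝ)] 1 := by
  have hJ0 : (0 : ℝ) ≤ J := Nat.cast_nonneg J
  have hE : ∀ n, poch (α + J + 3) n ≠ 0 := fun n => (poch_pos (by linarith) n).ne'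
  have hF : ∀ n, poch (α + J + 5 / 2) n ≠ 0 := fun n => (poch_pos (by linarith) n).ne'
  have hd := poch_add_one_ne_zero hα
  have hH : ∀ {m}, m ≤ J → poch (1 / 2 - ((J + 1 : ℕ) : ℝ)) m ≠ 0 :=
    fun h => poch_half_sub_ne_zero (h.trans (Nat.le_succ J))
  have hD := sum_sum_poch_add K L (a := K + α + 3 / 2) (a' := L + α + 3 / 2) (d := α + 1)
    (e := α + J + 3) (e' := -(J : ℝ)) (f := 1 / 2 - ((J + 1 : ℕ) : ℝ)) (f' := α + J + 5 / 2)
    (by push_cast; ring) (by ring) hd (hH hK) (hE K) (hF L) (poch_neg_natCast_ne_zero hL)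
  have hJ1 : (J : ℝ) + 1 ≠ 0 := by positivity
  have hA0 : α + J + 2 ≠ 0 := by linarith
  have hN : ∀ m, poch (-((2 * (J + 1) : ℕ) : ℝ)) (2 * m + 1) =
      -(2 * (J + 1)) * (4 ^ m * poch (-(J : ℝ)) m * poch (1 / 2 - ((J + 1 : ℕ) : ℝ)) m) := by
    intro m
    rw [poch_succ_left, poch_two_mul,
      show (-((2 * (J + 1) : ℕ) : ℝ) + 1) / 2 = 1 / 2 - ((J + 1 : ℕ) : ℝ) by push_cast; ring,
      show (-((2 * (J + 1) : ℕ) : ℝ) + 1 + 1) / 2 = -J by push_cast; ring]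
    push_cast
    ring
  have hA : ∀ p, poch ((2 * (J + 1) : ℕ) + 2 * α + 2) (2 * p + 1) =
      2 * (α + J + 2) * (4 ^ p * poch (α + J + 3) p * poch (α + J + 5 / 2) p) := by
    intro p
    rw [poch_succ_left, poch_two_mul,
      show ((2 * (J + 1) : ℕ) + 2 * α + 2 + 1 : ℝ) / 2 = α + J + 5 / 2 by push_cast; ring,
      show ((2 * (J + 1) : ℕ) + 2 * α + 2 + 1 + 1 : ℝ) / 2 = α + J + 3 by push_cast; ring]
    push_cast
    ring
  have hS := sum_hahnW_mul_expansions 2 α (K := K) (L := L) (N := 2 * (J + 1)) (by omega)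
    (fun m => poch (-(K : ℝ)) m * poch (K + α + 3 / 2) m / (poch (α + 1) m * (m ! : ℝ)) *
        (4 ^ m / poch (-((2 * (J + 1) : ℕ) : ℝ)) (2 * m + 1)))
    (fun p => poch (-(L : ℝ)) p * poch (L + α + 3 / 2) p / (poch (α + 1) p * (p ! : ℝ)) *
        (4 ^ p / poch ((2 * (J + 1) : ℕ) + 2 * α + 2) (2 * p + 1)))
  have hT : ∑ m ∈ Finset.range (K + 1), ∑ p ∈ Finset.range (L + 1),
      (poch (-(K : ℝ)) m * poch (K + α + 3 / 2) m / (poch (α + 1) m * (m ! : ℝ)) *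
        (4 ^ m / poch (-((2 * (J + 1) : ℕ) : ℝ)) (2 * m + 1))) *
      (poch (-(L : ℝ)) p * poch (L + α + 3 / 2) p / (poch (α + 1) p * (p ! : ℝ)) *
        (4 ^ p / poch ((2 * (J + 1) : ℕ) + 2 * α + 2) (2 * p + 1))) *
      ((-1) ^ m * poch (α + 1) (m + p) ^ 2 * altSum 2 (α + m + p) (2 * (J + 1) - 2 * m)) =
      -poch (α + 1) (J + 2) / ((J + 1) * (α + J + 2) * (J ! : ℝ)) *
        (∑ m ∈ Finset.range (K + 1), ∑ p ∈ Finset.range (L + 1),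
        (poch (-(K : ℝ)) m * poch (K + α + 3 / 2) m /
          (poch (1 / 2 - ((J + 1 : ℕ) : ℝ)) m * (m ! : ℝ))) *
        (poch (-(L : ℝ)) p * poch (L + α + 3 / 2) p / (poch (α + J + 5 / 2) p * (p ! : ℝ))) *
        (poch (α + 1) (m + p) / (poch (α + 1) m * poch (α + 1) p))) := by
    simp_rw [Finset.mul_sum]
    refine Finset.sum_congr rfl fun m hm => Finset.sum_congr rfl fun p _ => ?_
    have hm' : m ≤ J := (Nat.lt_succ_iff.mp (Finset.mem_range.mp hm)).trans hK
    rw [altSum_two_moment α hm', hN, hA]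
    have := hE p
    have := hF p
    have := hd m
    have := hd p
    have := hH hm'
    have := poch_neg_natCast_ne_zero hm'
    have := Nat.factorial_ne_zero m
    have := Nat.factorial_ne_zero p
    have := Nat.factorial_ne_zero J
    generalize poch (1 / 2 - ((J + 1 : ℕ) : ℝ)) m = z at *
    field_simp
    ring
  have hT' := congrArg (fun T => poch ((2 * (J + 1) : ℕ) + 2 * α + 2) (2 * L + 1) /
      poch (-((2 * (J + 1) : ℕ) : ℝ)) (2 * L + 1) * T) (hS.trans (hT.trans (congrArg
      (fun T => -poch (α + 1) (J + 2) / ((J + 1) * (α + J + 2) * (J ! : ℝ)) * T) hD)))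
  beta_reduce at hT'
  have h1 : kernelS (2 * K + 1) (2 * L + 1) α (2 * (J + 1)) = _ := Eq.trans (by
    rw [kernelS, Finset.mul_sum]
    refine Finset.sum_congr rfl fun n _ => ?_
    rw [hahnQ_odd hα (by omega), hahnQ_odd_dual hα (by omega)]
    ring) hT'
  have h2 := poch_half_mul (hK.trans (Nat.le_succ J))
  have h3 := poch_half_mul (hL.trans (Nat.le_succ J))
  have := hE L
  have := hF L
  have := hH hK
  have := hH hL
  have := poch_neg_natCast_ne_zero hL
  have := Nat.factorial_ne_zero J
  have h4 : poch (1 / 2) (J + 1) ≠ 0 := (poch_pos (by norm_num) _).ne'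
  have e1 := eq_div_of_mul_eq (hH hK) h2
  have e2 := eq_div_of_mul_eq (hH hL) h3
  rw [h1, hypSeries_four_three, hN, hA, factorial_two_mul, pow_mul, e1, e2,
    show (2 : ℝ) ^ 2 = 4 by norm_num, Nat.factorial_succ, Nat.cast_mul, Nat.cast_succ J]
  rw [Nat.cast_succ J] at *
  generalize poch (1 / 2 - ((J : ℝ) + 1)) K = z at *
  generalize poch (1 / 2 - ((J : ℝ) + 1)) L = z' at *
  generalize poch (α + J + 5 / 2) L = y at *
  generalize Finset.sum (M := ℝ) (Finset.range (K + 1)) _ = T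
  field_simp

/-- The single odd degree gives exponent one. The even-degree polynomial takes the first basis and
the odd-degree one the second. -/
theorem kernelS_even_odd {α : ℝ} (hα : -1 < α) {J K L : ℕ} (hK : K ≤ J) (hL : L ≤ J) :
    kernelS (2 * K) (2 * L + 1) α (2 * J + 1) =
      2 ^ (2 * J + 1) * poch (1 / 2) (J - K + 1) * poch (1 / 2) (J - L) *
          poch (α + 1) (J + 1) * poch (α + J + 2) K * poch (α + J + 2) L /
          (((2 * J + 1)! : ℝ) * poch (1 / 2) (J + 1)) *
        hypSeries [-(K : ℝ), K + α + 1 / 2, -(L : ℝ), L + α + 3 / 2]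
          [α + J + 2, α + 1, -(J : ℝ)] 1 := by
  have hJ0 : (0 : ℝ) ≤ J := Nat.cast_nonneg J
  have hE : ∀ n, poch (α + J + 2) n ≠ 0 := fun n => (poch_pos (by linarith) n).ne'
  have hF : ∀ n, poch (α + J + 5 / 2) n ≠ 0 := fun n => (poch_pos (by linarith) n).ne'
  have hd := poch_add_one_ne_zero hα
  have hH : ∀ {m}, m ≤ J → poch (1 / 2 - ((J + 1 : ℕ) : ℝ)) m ≠ 0 :=
    fun h => poch_half_sub_ne_zero (h.trans (Nat.le_succ J))
  have hD := sum_sum_poch_add K L (a := K + α + 1 / 2) (a' := L + α + 3 / 2) (d := α + 1)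
    (e := α + J + 2) (e' := -(J : ℝ)) (f := 1 / 2 - ((J + 1 : ℕ) : ℝ)) (f' := α + J + 5 / 2)
    (by push_cast; ring) (by ring) hd (hH hK) (hE K) (hF L) (poch_neg_natCast_ne_zero hL)
  have hA0 : 2 * (α + J) + 3 ≠ 0 := by linarith
  have hN : ∀ m, poch (-((2 * J + 1 : ℕ) : ℝ)) (2 * m) =
      4 ^ m * poch (-(J : ℝ)) m * poch (1 / 2 - ((J + 1 : ℕ) : ℝ)) m := by
    intro m
    rw [poch_two_mul,
      show -((2 * J + 1 : ℕ) : ℝ) / 2 = 1 / 2 - ((J + 1 : ℕ) : ℝ) by push_cast; ring,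
      show (-((2 * J + 1 : ℕ) : ℝ) + 1) / 2 = -J by push_cast; ring]
    ring
  -- Only the prefactor of the second expansion needs this odd-length symbol. Splitting off its
  -- first factor leaves `1 / 2 - J` instead of `1 / 2 - (J + 1)`, whence the asymmetry between `J -
  -- K + 1` and `J - L` in the result.
  have hN1 : poch (-((2 * J + 1 : ℕ) : ℝ)) (2 * L + 1) =
      -(2 * J + 1) * (4 ^ L * poch (-(J : ℝ)) L * poch (1 / 2 - (J : ℝ)) L) := by
    rw [poch_succ_left, poch_two_mul,
      show (-((2 * J + 1 : ℕ) : ℝ) + 1) / 2 = -J by push_cast; ring,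
      show (-((2 * J + 1 : ℕ) : ℝ) + 1 + 1) / 2 = 1 / 2 - J by push_cast; ring]
    push_cast
    ring
  have hA : ∀ p, poch ((2 * J + 1 : ℕ) + 2 * α + 2) (2 * p + 1) =
      (2 * (α + J) + 3) * (4 ^ p * poch (α + J + 2) p * poch (α + J + 5 / 2) p) := by
    intro p
    rw [poch_succ_left, poch_two_mul,
      show ((2 * J + 1 : ℕ) + 2 * α + 2 + 1 : ℝ) / 2 = α + J + 2 by push_cast; ring,
      show ((2 * J + 1 : ℕ) + 2 * α + 2 + 1 + 1 : ℝ) / 2 = α + J + 5 / 2 by push_cast; ring]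
    push_cast
    ring
  have hS := sum_hahnW_mul_expansions 1 α (K := K) (L := L) (N := 2 * J + 1) (by omega)
    (fun m => poch (-(K : ℝ)) m * poch (K + α + 1 / 2) m / (poch (α + 1) m * (m ! : ℝ)) *
        (4 ^ m / poch (-((2 * J + 1 : ℕ) : ℝ)) (2 * m)))
    (fun p => poch (-(L : ℝ)) p * poch (L + α + 3 / 2) p / (poch (α + 1) p * (p ! : ℝ)) *
        (4 ^ p / poch ((2 * J + 1 : ℕ) + 2 * α + 2) (2 * p + 1)))
  have hT : ∑ m ∈ Finset.range (K + 1), ∑ p ∈ Finset.range (L + 1),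
      (poch (-(K : ℝ)) m * poch (K + α + 1 / 2) m / (poch (α + 1) m * (m ! : ℝ)) *
        (4 ^ m / poch (-((2 * J + 1 : ℕ) : ℝ)) (2 * m))) *
      (poch (-(L : ℝ)) p * poch (L + α + 3 / 2) p / (poch (α + 1) p * (p ! : ℝ)) *
        (4 ^ p / poch ((2 * J + 1 : ℕ) + 2 * α + 2) (2 * p + 1))) *
      ((-1) ^ m * poch (α + 1) (m + p) ^ 2 * altSum 1 (α + m + p) (2 * J + 1 - 2 * m)) =
      2 * poch (α + 1) (J + 1) / ((2 * (α + J) + 3) * (J ! : ℝ)) *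
        (∑ m ∈ Finset.range (K + 1), ∑ p ∈ Finset.range (L + 1),
        (poch (-(K : ℝ)) m * poch (K + α + 1 / 2) m /
          (poch (1 / 2 - ((J + 1 : ℕ) : ℝ)) m * (m ! : ℝ))) *
        (poch (-(L : ℝ)) p * poch (L + α + 3 / 2) p / (poch (α + J + 5 / 2) p * (p ! : ℝ))) *
        (poch (α + 1) (m + p) / (poch (α + 1) m * poch (α + 1) p))) := by
    simp_rw [Finset.mul_sum]
    refine Finset.sum_congr rfl fun m hm => Finset.sum_congr rfl fun p _ => ?_
    have hm' : m ≤ J := (Nat.lt_succ_iff.mp (Finset.mem_range.mp hm)).trans hK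
    rw [altSum_one_moment α hm', hN, hA]
    have := hE p
    have := hF p
    have := hd m
    have := hd p
    have := hH hm'
    have := poch_neg_natCast_ne_zero hm'
    have := Nat.factorial_ne_zero m
    have := Nat.factorial_ne_zero p
    have := Nat.factorial_ne_zero J
    generalize poch (1 / 2 - ((J + 1 : ℕ) : ℝ)) m = z at *
    field_simp
  have hT' := congrArg (fun T => -poch ((2 * J + 1 : ℕ) + 2 * α + 2) (2 * L + 1) /
      poch (-((2 * J + 1 : ℕ) : ℝ)) (2 * L + 1) * T)
    (hS.trans (hT.trans (congrArg
      (fun T => 2 * poch (α + 1) (J + 1) / ((2 * (α + J) + 3) * (J ! : ℝ)) * T) hD)))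
  beta_reduce at hT'
  have h1 : kernelS (2 * K) (2 * L + 1) α (2 * J + 1) = _ := Eq.trans (by
    rw [kernelS, Finset.mul_sum]
    refine Finset.sum_congr rfl fun n _ => ?_
    rw [hahnQ_even hα (by omega), hahnQ_odd_dual hα (by omega)]
    ring) hT'
  have h2 := poch_half_mul (hK.trans (Nat.le_succ J))
  have h3 := poch_half_mul hL
  have := hE L
  have := hF L
  have := hH hK
  have := poch_half_sub_ne_zero hL
  have := poch_neg_natCast_ne_zero hL
  have := Nat.factorial_ne_zero J
  have h4 : poch (1 / 2) J ≠ 0 := (poch_pos (by norm_num) _).ne'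
  have h5 : (2 * (J : ℝ) + 1) ≠ 0 := by positivity
  have e1 := eq_div_of_mul_eq (hH hK) h2
  have e2 := eq_div_of_mul_eq (poch_half_sub_ne_zero hL) h3
  rw [Nat.succ_sub hK] at e1
  rw [h1, hypSeries_four_three, hN1, hA, Nat.factorial_succ, Nat.cast_mul, factorial_two_mul,
    pow_succ, pow_mul, e1, e2, show (2 : ℝ) ^ 2 = 4 by norm_num, poch_succ (1 / 2)]
  push_cast at *
  have h6 : (1 : ℝ) / 2 + J ≠ 0 := by positivity
  generalize poch (1 / 2 - ((J : ℝ) + 1)) K = z at *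
  generalize poch (1 / 2 - (J : ℝ)) L = z' at *
  generalize poch (α + J + 5 / 2) L = y at *
  generalize Finset.sum (M := ℝ) (Finset.range (K + 1)) _ = T
  field_simp

/-! ### Duality, parity, Racah form and positivity. -/

/-- Hahn and dual Hahn polynomials are the same series with degree and variable exchanged, term by
term. -/
theorem kernelS_eq_dualHahnPoissonKernel (k l : ℕ) (α : ℝ) (j : ℕ) :
    kernelS k l α j = dualHahnPoissonKernel (-1) k l α α j := by
  have h : ∀ m n : ℕ, hahnQ m (n : ℝ) α α j = dualHahnR n (m : ℝ) α α j := by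
    intro m n
    rw [hahnQ, dualHahnR, hypSeries, hypSeries]
    refine tsum_congr fun i => ?_
    simp only [List.map_cons, List.map_nil, List.prod_cons, List.prod_nil]
    ring
  rw [kernelS, dualHahnPoissonKernel]
  refine Finset.sum_congr rfl fun n _ => ?_
  rw [h, h, hahnW, add_comm (j : ℝ) α]

theorem kernelS_comm (k l : ℕ) (α : ℝ) (j : ℕ) : kernelS k l α j = kernelS l k α j := by
  rw [kernelS, kernelS]
  exact Finset.sum_congr rfl fun n _ => by ring

/-- Under `n ↦ j - n` the weight is invariant, the alternating sign gains `(-1) ^ j`, and the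
polynomials gain `(-1) ^ k` and `(-1) ^ l`. -/
theorem kernelS_parity {α : ℝ} (hα : -1 < α) {j k l : ℕ} (hk : k ≤ j) (hl : l ≤ j) :
    kernelS k l α j = (-1) ^ (k + l + j) * kernelS k l α j := by
  conv_lhs => rw [kernelS, ← Finset.sum_range_reflect]
  rw [kernelS, Finset.mul_sum]
  refine Finset.sum_congr rfl fun n hn => ?_
  have hn' : n ≤ j := Nat.lt_succ_iff.mp (Finset.mem_range.mp hn)
  rw [show j + 1 - 1 - n = j - n by omega, hahnW_eq _ _ (Nat.sub_le j n), hahnW_eq _ _ hn',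
    Nat.sub_sub_self hn', Nat.cast_sub hn', hahnQ_reflect hα hk, hahnQ_reflect hα hl]
  have h1 : (-1 : ℝ) ^ (j - n) = (-1) ^ j * (-1) ^ n := by
    obtain ⟨t, rfl⟩ := Nat.exists_eq_add_of_le hn'
    have : (-1 : ℝ) ^ n * (-1) ^ n = 1 := by rw [← mul_pow]; simp
    rw [Nat.add_sub_cancel_left, pow_add]
    linear_combination -(-1) ^ t * this
  rw [h1]
  ring

theorem kernelS_eq_zero {α : ℝ} (hα : -1 < α) {j k l : ℕ} (hk : k ≤ j) (hl : l ≤ j)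
    (h : Odd (k + l + j)) : kernelS k l α j = 0 := by
  have := kernelS_parity hα hk hl
  rw [h.neg_one_pow] at this
  linarith

theorem isTerminatingSaalschutzian_four_three {a a' d e e' : ℝ} (K : ℕ) (b : ℝ)
    (hsum : e + d + e' = 1 + (-K + a + b + a')) (he : 0 < e) (hd : 0 < d) {J : ℕ}
    (he' : e' = -J) (hJ : K ≤ J) :
    IsTerminatingSaalschutzian [-(K : ℝ), a, b, a'] [e, d, e'] := by
  refine ⟨rfl, ?_, K, by simp, ?_⟩
  · simp only [List.sum_cons, List.sum_nil]
    linarith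
  · simp only [List.mem_cons, List.not_mem_nil, or_false]
    rintro x (rfl | rfl | rfl) i hi
    · positivity
    · positivity
    · rw [he']
      have : (i : ℝ) < J := by exact_mod_cast hi.trans_le hJ
      linarith

theorem racahR_eq_four_three (K L : ℕ) {α β γ δ a a' e e' : ℝ} (ha : K + α + β + 1 = a)
    (ha' : L + γ + δ + 1 = a') (he : β + δ + 1 = e) (he' : γ + 1 = e') :
    racahR K (L : ℝ) α β γ δ = hypSeries [-(K : ℝ), a, -(L : ℝ), a'] [e, α + 1, e'] 1 := by
  subst ha ha' he he'
  rw [racahR, hypSeries, hypSeries]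
  refine tsum_congr fun i => ?_
  simp only [List.map_cons, List.map_nil, List.prod_cons, List.prod_nil]
  ring

theorem kernelS_eq_kernelFactor_mul {α : ℝ} (hα : -1 < α) {j k l : ℕ} (hk : k ≤ j)
    (hl : l ≤ j) (h : Even (k + l + j)) :
    kernelS k l α j = kernelFactor k l α j * kernelRacah k l α j := by
  have e0 : ∀ n : ℕ, 2 * n / 2 = n := fun n => by omega
  have e1 : ∀ n : ℕ, (2 * n + 1) / 2 = n := fun n => by omega
  have hodd : ∀ n : ℕ, ¬ Even (2 * n + 1) := fun n => by simp
  have hev : ∀ n : ℕ, Even (2 * n) := fun n => even_two_mul n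
  rcases Nat.even_or_odd' k with ⟨K, rfl | rfl⟩ <;>
  rcases Nat.even_or_odd' l with ⟨L, rfl | rfl⟩ <;>
  rcases Nat.even_or_odd' j with ⟨J, rfl | rfl⟩
  · rw [kernelS_even_even hα (by omega) (by omega), kernelFactor, kernelRacah]
    simp only [e0, hev, if_true]
    rw [racahR_eq_four_three (a := K + α + 1 / 2) (a' := L + α + 1 / 2) (e := α + J + 1)
      (e' := -(J : ℝ))] <;> ring
  · exact absurd h (by simp [parity_simps])
  · exact absurd h (by simp [parity_simps])
  · rw [kernelS_even_odd hα (by omega) (by omega), kernelFactor, kernelRacah]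
    simp only [e0, e1, hev, hodd, if_true, if_false]
    rw [racahR_eq_four_three (a := K + α + 1 / 2) (a' := L + α + 3 / 2) (e := α + J + 2)
      (e' := -(J : ℝ))] <;> ring
  · exact absurd h (by simp [parity_simps])
  · rw [kernelS_comm, kernelS_even_odd hα (by omega) (by omega), kernelFactor, kernelRacah]
    simp only [e0, e1, hev, hodd, if_true, if_false]
    rw [racahR_eq_four_three (a := L + α + 1 / 2) (a' := K + α + 3 / 2) (e := α + J + 2)
      (e' := -(J : ℝ))] <;> ring
  · obtain ⟨J, rfl⟩ := Nat.exists_eq_succ_of_ne_zero (by omega : J ≠ 0)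
    rw [Nat.succ_eq_add_one, kernelS_odd_odd hα (by omega) (by omega), kernelFactor, kernelRacah]
    simp only [e0, e1, hodd, if_false]
    rw [racahR_eq_four_three (a := K + α + 3 / 2) (a' := L + α + 3 / 2) (e := α + J + 3)
      (e' := -(J : ℝ))]
    · push_cast
      rw [show α + (J + 1) + 2 = α + J + 3 by ring]
    all_goals push_cast; ring
  · exact absurd h (by simp [parity_simps])

theorem kernelFactor_pos {α : ℝ} (hα : -1 < α) {j k l : ℕ} (hk : k ≤ j)
    (h : Even (k + l + j)) : 0 < kernelFactor k l α j := by
  have hJ : (0 : ℝ) ≤ (j / 2 : ℕ) := Nat.cast_nonneg _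
  have h0 : ∀ n, 0 < poch (1 / 2) n := poch_pos (by norm_num)
  have h1 : ∀ n, 0 < poch (α + 1) n := poch_pos (by linarith)
  have h2 : ∀ n, 0 < poch (α + (j / 2 : ℕ) + 1) n := poch_pos (by linarith)
  have h3 : ∀ n, 0 < poch (α + (j / 2 : ℕ) + 2) n := poch_pos (by linarith)
  rw [kernelFactor]
  dsimp only
  split_ifs with hk' hl' hl'
  · have := h0 (j / 2 - k / 2)
    have := h0 (j / 2 - l / 2)
    have := h0 (j / 2)
    have := h1 (j / 2)
    have := h2 (k / 2)
    have := h2 (l / 2)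
    positivity
  · have := h0 (j / 2 - k / 2 + 1)
    have := h0 (j / 2 - l / 2)
    have := h0 (j / 2 + 1)
    have := h1 (j / 2 + 1)
    have := h3 (k / 2)
    have := h3 (l / 2)
    positivity
  · have := h0 (j / 2 - l / 2 + 1)
    have := h0 (j / 2 - k / 2)
    have := h0 (j / 2 + 1)
    have := h1 (j / 2 + 1)
    have := h3 (k / 2)
    have := h3 (l / 2)
    positivity
  · have := h0 (j / 2 - k / 2)
    have := h0 (j / 2 - l / 2)
    have := h0 (j / 2)
    have := h1 (j / 2 + 1)
    have := h3 (k / 2)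
    have := h3 (l / 2)
    -- The odd-odd prefactor divides by `J`; an odd `k ≤ j` with `j` even forces `J ≥ 1`.
    have hj : (0 : ℝ) < (j / 2 : ℕ) := by
      rw [Nat.cast_pos]
      rw [Nat.not_even_iff] at hk' hl'
      rw [Nat.even_iff] at h
      omega
    positivity

/-! ### Entries of the discrete Hahn–Fourier matrix. -/

theorem hahnW_nonneg {α : ℝ} (hα : -1 < α) {x N : ℕ} (h : x ≤ N) : 0 ≤ hahnW x α α N := by
  have h1 : ∀ n, 0 < negBinom α n := fun n =>
    div_pos (poch_pos (by linarith) n) (by positivity)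
  rw [hahnW_eq x α h]
  exact (mul_pos (h1 _) (h1 _)).le

theorem hahnH_pos {α : ℝ} (hα : -1 < α) {n N : ℕ} (h : n ≤ N) : 0 < hahnH n α α N := by
  have hn : (0 : ℝ) ≤ n := Nat.cast_nonneg n
  have hN : (n : ℝ) ≤ N := by exact_mod_cast h
  -- For `n = 0` the base `2α + 1` may be negative or zero, but the product is empty.
  have h1 : 0 < poch (n + α + α + 1) n := by
    cases n with
    | zero => simp [poch_zero]
    | succ n =>
      apply poch_pos
      have : (0 : ℝ) ≤ n := Nat.cast_nonneg n
      push_cast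
      linarith
  have h2 : 0 < poch (2 * (n : ℝ) + α + α + 2) (N - n) := poch_pos (by linarith) _
  have h3 : 0 < poch (α + 1) n := poch_pos (by linarith) _
  have h4 : 0 < poch ((N : ℝ) - n + 1) n := poch_pos (by linarith) _
  rw [hahnH]
  positivity

theorem hahnFun_mul_hahnFun {α : ℝ} (hα : -1 < α) {k l x N : ℕ} (hk : k ≤ N) (hx : x ≤ N) :
    hahnFun k x α α N * hahnFun l x α α N =
      hahnW x α α N * hahnQ k x α α N * hahnQ l x α α N /
        √(hahnH k α α N * hahnH l α α N) := by
  have h1 := Real.mul_self_sqrt (hahnW_nonneg hα hx)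
  rw [hahnFun, hahnFun, Real.sqrt_mul (hahnH_pos hα hk).le, div_mul_div_comm]
  congr 1
  linear_combination hahnQ k x α α N * hahnQ l x α α N * h1

theorem sum_hahnFun_mul_hahnFun {α : ℝ} (hα : -1 < α) {k l N : ℕ} (hk : k ≤ N) :
    ∑ x ∈ Finset.range (N + 1), (-1) ^ x * (hahnFun k x α α N * hahnFun l x α α N) =
      kernelS k l α N / √(hahnH k α α N * hahnH l α α N) := by
  rw [kernelS, Finset.sum_div]
  refine Finset.sum_congr rfl fun x hx => ?_
  rw [hahnFun_mul_hahnFun hα hk (Nat.lt_succ_iff.mp (Finset.mem_range.mp hx))]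
  ring

theorem sum_range_two_mul_add_one {M : Type*} [AddCommMonoid M] (f : ℕ → M) (j : ℕ) :
    ∑ s ∈ Finset.range (2 * j + 1), f s =
      ∑ i ∈ Finset.range (j + 1), f (2 * i) + ∑ i ∈ Finset.range j, f (2 * i + 1) := by
  induction j with
  | zero => simp
  | succ j ih =>
    rw [show 2 * (j + 1) + 1 = 2 * j + 1 + 1 + 1 by ring, Finset.sum_range_succ,
      Finset.sum_range_succ, ih, Finset.sum_range_succ _ (j + 1),
      Finset.sum_range_succ (fun i => f (2 * i + 1)) j,
      show 2 * (j + 1) = 2 * j + 1 + 1 by ring]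
    abel

theorem offs_le (j : ℕ) (c : Fin (2 * j + 1)) : offs j c ≤ j := by
  have := c.2
  unfold offs
  omega

/-- The entries of the discrete Hahn–Fourier matrix in terms of the alternating kernels. -/
theorem hahnFourier_apply {α : ℝ} (hα : -1 < α) (j : ℕ) (r c : Fin (2 * j + 1)) :
    hahnFourier α j r c =
      -Complex.I * ((colNorm (offs j r) * colNorm (offs j c) /
        √(hahnH (offs j r) α α j * hahnH (offs j c) α α j) *
        kernelS (offs j r) (offs j c) α j : ℝ) : ℂ) +
      if offs j r = 0 ∨ offs j c = 0 then 0 else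
        (side j r * side j c : ℂ) * ((1 / (2 * √(hahnH (offs j r - 1) (α + 1) (α + 1) (j - 1) *
          hahnH (offs j c - 1) (α + 1) (α + 1) (j - 1))) *
          kernelS (offs j r - 1) (offs j c - 1) (α + 1) (j - 1) : ℝ) : ℂ) := by
  have hr := offs_le j r
  have hc := offs_le j c
  -- The row index of `U` is extended to all natural numbers, so that the sum can be split by
  -- parity.
  set u : ℕ → Fin (2 * j + 1) → ℝ := fun s c =>
    if Even s then (-1) ^ (s / 2) * colNorm (offs j c) * hahnFun (offs j c) (s / 2) α α j
    else if offs j c = 0 then 0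
    else side j c * ((-1) ^ (s / 2) / √2) *
      hahnFun (offs j c - 1) (s / 2) (α + 1) (α + 1) (j - 1) with hu
  have h0 : hahnFourier α j r c = ∑ s ∈ Finset.range (2 * j + 1),
      (u s r : ℂ) * (-Complex.I ^ (s + 1) * (u s c : ℂ)) := by
    rw [← Fin.sum_univ_eq_sum_range (fun s => (u s r : ℂ) * (-Complex.I ^ (s + 1) * (u s c : ℂ)))]
    rfl
  have hsq : ∀ i : ℕ, (-1 : ℝ) ^ i * (-1) ^ i = 1 := fun i => by rw [← mul_pow]; simp
  rw [h0, sum_range_two_mul_add_one]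
  congr 1
  · have e : ∀ i ∈ Finset.range (j + 1),
        (u (2 * i) r : ℂ) * (-Complex.I ^ (2 * i + 1) * (u (2 * i) c : ℂ)) =
        -Complex.I * ((colNorm (offs j r) * colNorm (offs j c) *
          ((-1) ^ i * (hahnFun (offs j r) i α α j * hahnFun (offs j c) i α α j)) : ℝ) : ℂ) := by
      intro i _
      have h1 : u (2 * i) r * u (2 * i) c = colNorm (offs j r) * colNorm (offs j c) *
          (hahnFun (offs j r) i α α j * hahnFun (offs j c) i α α j) := by
        simp only [hu, even_two_mul, if_true, Nat.mul_div_cancel_left i two_pos]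
        linear_combination colNorm (offs j r) * colNorm (offs j c) *
          (hahnFun (offs j r) i α α j * hahnFun (offs j c) i α α j) * hsq i
      have h2 := congrArg ((↑) : ℝ → ℂ) h1
      -- The signs `(-1) ^ i` of the two entries cancel; the alternating sign of `S` comes from `I ^
      -- (2 i + 1) = (-1) ^ i I`.
      rw [pow_succ, pow_mul, Complex.I_sq]
      push_cast at h2 ⊢
      linear_combination -(-1) ^ i * Complex.I * h2
    rw [Finset.sum_congr rfl e, ← Finset.mul_sum, ← Complex.ofReal_sum, ← Finset.mul_sum,
      sum_hahnFun_mul_hahnFun hα hr]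
    congr 2
    ring
  · split_ifs with h
    · refine Finset.sum_eq_zero fun i _ => ?_
      have hodd : ¬ Even (2 * i + 1) := by simp
      rcases h with h | h <;> simp [hu, hodd, h]
    · obtain ⟨hr0, hc0⟩ := not_or.mp h
      have e : ∀ i ∈ Finset.range (j - 1 + 1),
          (u (2 * i + 1) r : ℂ) * (-Complex.I ^ (2 * i + 1 + 1) * (u (2 * i + 1) c : ℂ)) =
          (side j r * side j c : ℂ) * ((1 / 2 *
            ((-1) ^ i * (hahnFun (offs j r - 1) i (α + 1) (α + 1) (j - 1) *
              hahnFun (offs j c - 1) i (α + 1) (α + 1) (j - 1))) : ℝ) : ℂ) := by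
        intro i _
        have hodd : ¬ Even (2 * i + 1) := by simp
        have h1 : u (2 * i + 1) r * u (2 * i + 1) c = side j r * side j c * (1 / 2 *
            (hahnFun (offs j r - 1) i (α + 1) (α + 1) (j - 1) *
              hahnFun (offs j c - 1) i (α + 1) (α + 1) (j - 1))) := by
          have h3 : (1 / √2 : ℝ) * (1 / √2) = 1 / 2 := by
            rw [div_mul_div_comm, Real.mul_self_sqrt (by norm_num), one_mul]
          simp only [hu, hodd, if_false, hr0, hc0, show (2 * i + 1) / 2 = i by omega]
          rw [← h3]
          linear_combination side j r * side j c * (1 / √2 * (1 / √2) *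
            (hahnFun (offs j r - 1) i (α + 1) (α + 1) (j - 1) *
              hahnFun (offs j c - 1) i (α + 1) (α + 1) (j - 1))) * hsq i
        have h2 := congrArg ((↑) : ℝ → ℂ) h1
        rw [show 2 * i + 1 + 1 = 2 * (i + 1) by ring, pow_mul, Complex.I_sq, pow_succ]
        push_cast at h2 ⊢
        linear_combination (-1) ^ i * h2
      -- A nonzero offset is at most `j`, so `j ≥ 1` and the truncated subtraction is exact.
      rw [show Finset.range j = Finset.range (j - 1 + 1) by congr 1; omega,
        Finset.sum_congr rfl e, ← Finset.mul_sum, ← Complex.ofReal_sum, ← Finset.mul_sum,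
        sum_hahnFun_mul_hahnFun (by linarith) (by omega)]
      congr 2
      rw [one_div, one_div, mul_inv]
      ring

theorem theorem7 (α : ℝ) (hα : -1 < α) :
    -- `S` is the Poisson kernel for dual Hahn polynomials at `t = -1` and `β = α`
    (∀ j k l : ℕ, k ≤ j → l ≤ j →
      kernelS k l α j = dualHahnPoissonKernel (-1) k l α α j) ∧
    -- parity
    (∀ j k l : ℕ, k ≤ j → l ≤ j →
      kernelS k l α j = (-1) ^ (k + l + j) * kernelS k l α j) ∧
    (∀ j k l : ℕ, k ≤ j → l ≤ j → Odd (k + l + j) → kernelS k l α j = 0) ∧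
    -- `(2K, 2L, 2J)`
    (∀ J K L : ℕ, 2 * K ≤ 2 * J → 2 * L ≤ 2 * J →
      IsTerminatingSaalschutzian
        [-(K : ℝ), K + α + 1 / 2, -(L : ℝ), L + α + 1 / 2] [α + J + 1, α + 1, -(J : ℝ)] ∧
      kernelS (2 * K) (2 * L) α (2 * J) =
        2 ^ (2 * J) * poch (1 / 2) (J - K) * poch (1 / 2) (J - L) * poch (α + 1) J *
            poch (α + J + 1) K * poch (α + J + 1) L / (((2 * J)! : ℝ) * poch (1 / 2) J) *
          hypSeries [-(K : ℝ), K + α + 1 / 2, -(L : ℝ), L + α + 1 / 2]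
            [α + J + 1, α + 1, -(J : ℝ)] 1) ∧
    -- `(2K + 1, 2L + 1, 2J)`
    (∀ J K L : ℕ, 2 * K + 1 ≤ 2 * J → 2 * L + 1 ≤ 2 * J →
      IsTerminatingSaalschutzian
        [-(K : ℝ), K + α + 3 / 2, -(L : ℝ), L + α + 3 / 2] [α + J + 2, α + 1, -(J : ℝ) + 1] ∧
      kernelS (2 * K + 1) (2 * L + 1) α (2 * J) =
        2 ^ (2 * J) * poch (1 / 2) (J - K) * poch (1 / 2) (J - L) * poch (α + 1) (J + 1) *
            poch (α + J + 2) K * poch (α + J + 2) L / (((2 * J)! : ℝ) * J * poch (1 / 2) J) *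
          hypSeries [-(K : ℝ), K + α + 3 / 2, -(L : ℝ), L + α + 3 / 2]
            [α + J + 2, α + 1, -(J : ℝ) + 1] 1) ∧
    -- `(2K, 2L + 1, 2J + 1)` and `(2L + 1, 2K, 2J + 1)`
    (∀ J K L : ℕ, 2 * K ≤ 2 * J + 1 → 2 * L + 1 ≤ 2 * J + 1 →
      IsTerminatingSaalschutzian
        [-(K : ℝ), K + α + 1 / 2, -(L : ℝ), L + α + 3 / 2] [α + J + 2, α + 1, -(J : ℝ)] ∧
      kernelS (2 * K) (2 * L + 1) α (2 * J + 1) =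
        2 ^ (2 * J + 1) * poch (1 / 2) (J - K + 1) * poch (1 / 2) (J - L) *
            poch (α + 1) (J + 1) * poch (α + J + 2) K * poch (α + J + 2) L /
            (((2 * J + 1)! : ℝ) * poch (1 / 2) (J + 1)) *
          hypSeries [-(K : ℝ), K + α + 1 / 2, -(L : ℝ), L + α + 3 / 2]
            [α + J + 2, α + 1, -(J : ℝ)] 1 ∧
      kernelS (2 * L + 1) (2 * K) α (2 * J + 1) =
        2 ^ (2 * J + 1) * poch (1 / 2) (J - K + 1) * poch (1 / 2) (J - L) *
            poch (α + 1) (J + 1) * poch (α + J + 2) K * poch (α + J + 2) L /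
            (((2 * J + 1)! : ℝ) * poch (1 / 2) (J + 1)) *
          hypSeries [-(K : ℝ), K + α + 1 / 2, -(L : ℝ), L + α + 3 / 2]
            [α + J + 2, α + 1, -(J : ℝ)] 1) ∧
    -- every entry of the discrete Hahn-Fourier matrix is a factor times a Racah polynomial
    (∀ (j : ℕ) (r c : Fin (2 * j + 1)),
      (Even (offs j r + offs j c + j) →
        0 < imFactor (offs j r) (offs j c) α j ∧
        hahnFourier α j r c =
          -Complex.I * (imFactor (offs j r) (offs j c) α j : ℂ) *
            (kernelRacah (offs j r) (offs j c) α j : ℂ)) ∧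
      (Odd (offs j r + offs j c + j) → offs j r ≠ 0 → offs j c ≠ 0 →
        0 < reFactor (offs j r) (offs j c) α j ∧
        hahnFourier α j r c =
          (side j r * side j c : ℂ) * (reFactor (offs j r) (offs j c) α j : ℂ) *
            (kernelRacah (offs j r - 1) (offs j c - 1) (α + 1) (j - 1) : ℂ)) ∧
      (Odd (offs j r + offs j c + j) → offs j r = 0 ∨ offs j c = 0 →
        hahnFourier α j r c = 0)) := by
  refine ⟨fun j k l _ _ => kernelS_eq_dualHahnPoissonKernel k l α j,
    fun j k l hk hl => kernelS_parity hα hk hl,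
    fun j k l hk hl h => kernelS_eq_zero hα hk hl h, ?_, ?_, ?_, ?_⟩
  · intro J K L hK hL
    have hJ : (0 : ℝ) ≤ J := Nat.cast_nonneg J
    exact ⟨isTerminatingSaalschutzian_four_three K _ (by ring) (by linarith) (by linarith) rfl
      (by omega), kernelS_even_even hα (by omega) (by omega)⟩
  · intro J K L hK hL
    obtain ⟨J, rfl⟩ := Nat.exists_eq_succ_of_ne_zero (by omega : J ≠ 0)
    have hJ : (0 : ℝ) ≤ J := Nat.cast_nonneg J
    have e1 : α + (J.succ : ℝ) + 2 = α + J + 3 := by push_cast; ring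
    have e2 : -(J.succ : ℝ) + 1 = -J := by push_cast; ring
    rw [e1, e2, Nat.cast_succ]
    exact ⟨isTerminatingSaalschutzian_four_three K _ (by ring) (by linarith) (by linarith) rfl
      (by omega), kernelS_odd_odd hα (by omega) (by omega)⟩
  · intro J K L hK hL
    have hJ : (0 : ℝ) ≤ J := Nat.cast_nonneg J
    have h := kernelS_even_odd hα (J := J) (K := K) (L := L) (by omega) (by omega)
    exact ⟨isTerminatingSaalschutzian_four_three K _ (by ring) (by linarith) (by linarith) rfl
      (by omega), h, (kernelS_comm _ _ _ _).trans h⟩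
  · intro j r c
    have hr := offs_le j r
    have hc := offs_le j c
    have hα' : -1 < α + 1 := by linarith
    refine ⟨fun h => ⟨?_, ?_⟩, fun h hr0 hc0 => ⟨?_, ?_⟩, fun h h0 => ?_⟩
    · have h1 : ∀ k, 0 < colNorm k := fun k => by
        unfold colNorm
        split_ifs <;> positivity
      have h2 := mul_pos (hahnH_pos hα hr) (hahnH_pos hα hc)
      exact mul_pos (div_pos (mul_pos (h1 _) (h1 _)) (Real.sqrt_pos.mpr h2))
        (kernelFactor_pos hα hr h)
    · rw [hahnFourier_apply hα, kernelS_eq_kernelFactor_mul hα hr hc h]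
      have hz : (if offs j r = 0 ∨ offs j c = 0 then (0 : ℂ) else
          (side j r * side j c : ℂ) *
            ((1 / (2 * √(hahnH (offs j r - 1) (α + 1) (α + 1) (j - 1) *
              hahnH (offs j c - 1) (α + 1) (α + 1) (j - 1))) *
              kernelS (offs j r - 1) (offs j c - 1) (α + 1) (j - 1) : ℝ) : ℂ)) = 0 := by
        split_ifs with h0
        · rfl
        -- Lowering `k`, `l` and `j` by one each changes the parity of their sum, so the
        -- contribution of the odd rows vanishes.
        · rw [kernelS_eq_zero hα' (by omega) (by omega)
            (by rw [Nat.even_iff] at h; rw [Nat.odd_iff]; omega)]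
          simp
      rw [hz, imFactor]
      push_cast
      ring
    · have h2 := mul_pos (hahnH_pos hα' (by omega : offs j r - 1 ≤ j - 1))
        (hahnH_pos hα' (by omega : offs j c - 1 ≤ j - 1))
      exact mul_pos (div_pos one_pos (mul_pos two_pos (Real.sqrt_pos.mpr h2)))
        (kernelFactor_pos hα' (by omega) (by rw [Nat.odd_iff] at h; rw [Nat.even_iff]; omega))
    · rw [hahnFourier_apply hα, kernelS_eq_zero hα hr hc h, if_neg (by tauto),
        kernelS_eq_kernelFactor_mul hα' (by omega) (by omega)
          (by rw [Nat.odd_iff] at h; rw [Nat.even_iff]; omega), reFactor]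
      push_cast
      ring
    · rw [hahnFourier_apply hα, kernelS_eq_zero hα hr hc h, if_pos h0]
      simp
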